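/- Let $\mathcal{E}$ be a category with finite limits such that for every morphism $f$ of $\mathcal{E}$ the pullback functor $\Delta_f$ between slice categories has a right adjoint $\Pi_f$. Let $\mathbf{Poly}(\mathcal{E})$ be the bicategory whose objects are those of $\mathcal{E}$ and whose 1-cells $I\to J$ are the polynomials $(s,p,t)$, i.e. diagrams $I\xleftarrow{s}E\xrightarrow{p}B\xrightarrow{t}J$, composed via pullbacks and distributivity pullbacks. Its 2-cells $(s,p,t)\Rightarrow(u,q,v)$, where $(u,q,v)$ is $I\xleftarrow{u}M\xrightarrow{q}N\xrightarrow{v}J$, are given by morphisms $g\colon B\to N$, $e_1\colon S\to E$ and $f_1\colon S\to M$ such that $vg=t$, $se_1=uf_1$ and $(pe_1,f_1)$ is a pullback of $(g,q)$, two such diagrams being identified if they differ by an isomorphism of the objects $S$ compatible with $e_1$ and $f_1$; such a 2-cell is written $[e_1,f_1;g]$. The remaining structure is the one for which polynomials and their 2-cells correspond to polynomial functors $\Sigma_t\Pi_p\Delta_s$ and strong natural transformations. For a morphism $f\colon X\to Y$ let $\pi_1,\pi_2\colon X\times_YX\to X$ be the projections and $\delta\colon X\to X\times_YX$ the diagonal.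 The following canonical comparison 2-cells are isomorphisms, and composites of 1-cells are identified along them: the composite of $(1,1,f)\colon X\to Y$ followed by $(f,1,1)\colon Y\to X$ is $(\pi_1,1,\pi_2)$; that of $(f,1,1)$ followed by $(1,1,f)$ is $(f,1,f)$; that of $(f,1,1)$ followed by $(1,f,1)\colon X\to Y$ is $(f,f,1)$; that of $(1,f,1)$ followed by $(f,1,1)$ is $(\pi_1,\pi_2,1)$. (1) For every $f\colon X\to Y$ there is an adjunction $(1_X,1_X,f)\dashv(f,1_X,1_X)$ in $\mathbf{Poly}(\mathcal{E})$ with unit $[1_X,\delta;\delta]\colon(1_X,1_X,1_X)\Rightarrow(\pi_1,1,\pi_2)$ and counit $[1_X,f;f]\colon(f,1_X,f)\Rightarrow(1_Y,1_Y,1_Y)$. (2) For every $f\colon X\to Y$ there is an adjunction $(f,1_X,1_X)\dashv(1_X,f,1_Y)$ in $\mathbf{Poly}(\mathcal{E})$ with unit $[f,1_X;1_Y]\colon(1_Y,1_Y,1_Y)\Rightarrow(f,f,1_Y)$ and counit $[\delta,1_X;1_X]\colon(\pi_1,\pi_2,1_X)\Rightarrow(1_X,1_X,1_X)$. (3) Every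 adjunction in $\mathbf{Poly}(\mathcal{E})$ is, up to isomorphism, a composite of adjunctions of these two forms. Precisely, for every adjunction $L\dashv R$ with $L\colon I\to J$ there are an object $K$, morphisms $g\colon K\to I$ and $f\colon K\to J$, and isomorphisms from $L$ to the composite of $(g,1,1)$ followed by $(1,1,f)$ and from $R$ to the composite of $(f,1,1)$ followed by $(1,g,1)$, which carry the unit and the counit of $L\dashv R$ to those of the composite of the adjunctions $(g,1,1)\dashv(1,g,1)$ of (2) and $(1,1,f)\dashv(f,1,1)$ of (1). -/

import Mathlib

open CategoryTheory CategoryTheory.Limits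

-- Morphisms of a category are to be found through its category structure only.
attribute [-instance] catToReflQuiver

universe v u

set_option linter.unusedSectionVars false

namespace PolyBicat

/-! ## Transport of a bicategory structure along local equivalences -/

section Transport

universe w₁ w₂ v₁ v₂ u₁ u₂

open Bicategory

variable {B : Type u₂} [Bicategory.{w₂, v₂} B]

/-- Objects `O`, 1-cells `H a b` and 2-cells (the categories `H a b`), together with composites of
1-cells and identity 1-cells, are made into a bicategory along a fully faithful assignment `F` into
a bicategory `B` that preserves composites and identities up to given isomorphisms `μ`, `ι`.
Whiskerings, associators and unitors are the unique ones that make `F` a pseudofunctor with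
constraints `μ`, `ι`. -/
@[reducible] def transportBicategory {O : Type u₁} (ob : O → B) (H : O → O → Type v₁)
    [hcat : ∀ a b, Category.{w₁} (H a b)]
    (F : ∀ a b, H a b ⥤ (ob a ⟶ ob b)) (ff : ∀ a b, (F a b).FullyFaithful)
    (one : ∀ a, H a a) (cmp : ∀ {a b c}, H a b → H b c → H a c)
    (μ : ∀ {a b c} (f : H a b) (g : H b c), (F a c).obj (cmp f g) ≅ (F a b).obj f ≫ (F b c).obj g)
    (ι : ∀ a, (F a a).obj (one a) ≅ 𝟙 (ob a)) : Bicategory.{w₁, v₁} O where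
  Hom := H
  id := one
  comp := cmp
  homCategory := hcat
  whiskerLeft {a b c} f {g h} η :=
    (ff a c).preimage ((μ f g).hom ≫ (F a b).obj f ◁ (F b c).map η ≫ (μ f h).inv)
  whiskerRight {a b c} {f g} η h :=
    (ff a c).preimage ((μ f h).hom ≫ (F a b).map η ▷ (F b c).obj h ≫ (μ g h).inv)
  associator {a b c d} f g h := (ff a d).preimageIso
    (μ (cmp f g) h ≪≫ whiskerRightIso (μ f g) ((F c d).obj h) ≪≫ α_ _ _ _ ≪≫
      whiskerLeftIso ((F a b).obj f) (μ g h).symm ≪≫ (μ f (cmp g h)).symm)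
  leftUnitor {a b} f := (ff a b).preimageIso
    (μ (one a) f ≪≫ whiskerRightIso (ι a) ((F a b).obj f) ≪≫ λ_ _)
  rightUnitor {a b} f := (ff a b).preimageIso
    (μ f (one b) ≪≫ whiskerLeftIso ((F a b).obj f) (ι b) ≪≫ ρ_ _)
  whiskerLeft_id f g := (ff _ _).map_injective (by simp)
  whiskerLeft_comp f _ _ _ η θ := (ff _ _).map_injective (by simp)
  id_whiskerLeft η := (ff _ _).map_injective (by
    simp; rw [← id_whiskerLeft_assoc, ← whisker_exchange_assoc]; simp)
  comp_whiskerLeft f g _ _ η := (ff _ _).map_injective (by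
    simp; rw [← comp_whiskerLeft_assoc, ← whisker_exchange_assoc]; simp)
  id_whiskerRight f g := (ff _ _).map_injective (by simp)
  comp_whiskerRight η θ i := (ff _ _).map_injective (by simp)
  whiskerRight_id η := (ff _ _).map_injective (by
    simp; rw [← whiskerRight_id_assoc, whisker_exchange_assoc]; simp)
  whiskerRight_comp η g h := (ff _ _).map_injective (by
    simp; rw [← whiskerRight_comp_assoc, whisker_exchange_assoc]; simp)
  whisker_assoc f _ _ η h := (ff _ _).map_injective (by simp)
  whisker_exchange η θ := (ff _ _).map_injective (by simp [whisker_exchange_assoc])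
  pentagon f g h i := (ff _ _).map_injective (by
    simp; rw [whisker_exchange_assoc]; simp)
  triangle f g := (ff _ _).map_injective (by simp)

end Transport

variable {C : Type u} [Category.{v} C]

/-! ## Families in context -/

/-- An `I`-indexed family in context `base`: a presheaf `El` on `C` (the generalised elements of
the family) with a map `pr` to the representable presheaf of the context `base` and a map `ix` to
the representable presheaf of `I`. The object `X` of `C` with `base ← X → I` is the
special case of a representable presheaf. -/
structure Fam (I : C) where
  /-- the context -/
  base : C
  /-- the generalised elements at a stage -/
  El : C → Type (max u v)
  /-- restriction along a change of stage -/
  res : ∀ {T' T : C}, (T' ⟶ T) → El T → El T'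
  res_id : ∀ {T : C} (x : El T), res (𝟙 T) x = x
  res_comp : ∀ {T'' T' T : C} (h : T'' ⟶ T') (k : T' ⟶ T) (x : El T),
    res (h ≫ k) x = res h (res k x)
  /-- the position in the context -/
  pr : ∀ {T : C}, El T → (T ⟶ base)
  pr_res : ∀ {T' T : C} (h : T' ⟶ T) (x : El T), pr (res h x) = h ≫ pr x
  /-- the index -/
  ix : ∀ {T : C}, El T → (T ⟶ I)
  ix_res : ∀ {T' T : C} (h : T' ⟶ T) (x : El T), ix (res h x) = h ≫ ix x

attribute [simp] Fam.res_id Fam.res_comp Fam.pr_res Fam.ix_res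

/-- A map of `I`-indexed families over a change of context. -/
@[ext]
structure FamHom {I : C} (X Y : Fam.{v, u} I) where
  /-- the change of context -/
  base : X.base ⟶ Y.base
  /-- the action on generalised elements -/
  app : ∀ {T : C}, X.El T → Y.El T
  app_res : ∀ {T' T : C} (h : T' ⟶ T) (x : X.El T), app (X.res h x) = Y.res h (app x)
  pr_app : ∀ {T : C} (x : X.El T), Y.pr (app x) = X.pr x ≫ base
  ix_app : ∀ {T : C} (x : X.El T), Y.ix (app x) = X.ix x

attribute [simp] FamHom.app_res FamHom.pr_app FamHom.ix_app

@[simps]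
instance (I : C) : Category (Fam.{v, u} I) where
  Hom := FamHom
  id X := { base := 𝟙 _, app := fun x => x, app_res := by simp, pr_app := by simp,
            ix_app := by simp }
  comp φ ψ := { base := φ.base ≫ ψ.base, app := fun x => ψ.app (φ.app x), app_res := by simp,
                pr_app := by simp, ix_app := by simp }

@[ext]
theorem Fam.hom_ext {I : C} {X Y : Fam.{v, u} I} {φ ψ : X ⟶ Y} (h : FamHom.base φ = FamHom.base ψ)
    (h' : ∀ {T : C} (x : X.El T), FamHom.app φ x = FamHom.app ψ x) : φ = ψ := by
  apply FamHom.ext h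
  funext T x
  exact h' x

/-- The fibred category (over the category of contexts `C`) of `I`-indexed families. -/
@[reducible] def famCat (I : C) : BasedCategory.{max u v, max u v + 1} C where
  obj := Fam.{v, u} I
  p := { obj := Fam.base, map := FamHom.base }

/-! ## Polynomials and their 2-cells -/

/-- A polynomial `I ← E → B → J`. -/
structure Poly (I J : C) where
  /-- the object of the middle arrow's source -/
  E : C
  /-- the object of the middle arrow's target -/
  B : C
  /-- the left leg -/
  s : E ⟶ I
  /-- the middle arrow -/
  p : E ⟶ B
  /-- the right leg -/
  t : B ⟶ J

namespace Poly

variable {I J K : C}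

/-- An element of the extension of `P` at the family `X` and at stage `Γ`. -/
structure Elt (P : Poly I J) (X : Fam.{v, u} I) (Γ : C) where
  /-- the position in the context -/
  d : Γ ⟶ X.base
  /-- the shape -/
  b : Γ ⟶ P.B
  /-- the elements of `X` over the positions of the shape -/
  x : ∀ {T : C} (a : T ⟶ Γ) (m : T ⟶ P.E), a ≫ b = m ≫ P.p → X.El T
  res_x : ∀ {T' T : C} (h : T' ⟶ T) (a : T ⟶ Γ) (m : T ⟶ P.E) (w : a ≫ b = m ≫ P.p),
    X.res h (x a m w) = x (h ≫ a) (h ≫ m) (by simp [w])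
  pr_x : ∀ {T : C} (a : T ⟶ Γ) (m : T ⟶ P.E) (w : a ≫ b = m ≫ P.p), X.pr (x a m w) = a ≫ d
  ix_x : ∀ {T : C} (a : T ⟶ Γ) (m : T ⟶ P.E) (w : a ≫ b = m ≫ P.p), X.ix (x a m w) = m ≫ P.s

attribute [simp] Elt.res_x Elt.pr_x Elt.ix_x

theorem Elt.ext' {P : Poly I J} {X : Fam.{v, u} I} {Γ : C} {y z : P.Elt X Γ} (hd : y.d = z.d)
    (hb : y.b = z.b)
    (hx : ∀ {T : C} (a : T ⟶ Γ) (m : T ⟶ P.E) (w : a ≫ y.b = m ≫ P.p) (w' : a ≫ z.b = m ≫ P.p),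
      y.x a m w = z.x a m w') : y = z := by
  obtain ⟨d, b, x, h1, h2, h3⟩ := y
  obtain ⟨d', b', x', h1', h2', h3'⟩ := z
  dsimp only at hd hb
  subst hd hb
  have : @x = @x' := by
    funext T a m w
    exact hx a m w w
  subst this
  rfl

theorem Elt.x_congr {P : Poly I J} {X : Fam.{v, u} I} {Γ : C} {y z : P.Elt X Γ} (h : y = z)
    {T : C} {a a' : T ⟶ Γ} {m m' : T ⟶ P.E} (ha : a = a') (hm : m = m')
    (w : a ≫ y.b = m ≫ P.p) (w' : a' ≫ z.b = m' ≫ P.p) : y.x a m w = z.x a' m' w' := by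
  subst h ha hm
  rfl

/-- Restriction of elements of the extension. -/
@[simps]
def Elt.restrict {P : Poly I J} {X : Fam.{v, u} I} {Γ' Γ : C} (h : Γ' ⟶ Γ) (y : P.Elt X Γ) :
    P.Elt X Γ' where
  d := h ≫ y.d
  b := h ≫ y.b
  x a m w := y.x (a ≫ h) m (by simpa using w)
  res_x := by simp
  pr_x := by simp
  ix_x := by simp

/-- Functoriality of the elements of the extension. -/
@[simps]
def Elt.push {P : Poly I J} {X Y : Fam.{v, u} I} (φ : FamHom X Y) {Γ : C} (y : P.Elt X Γ) :
    P.Elt Y Γ where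
  d := y.d ≫ φ.base
  b := y.b
  x a m w := φ.app (y.x a m w)
  res_x := by simp [← FamHom.app_res]
  pr_x := by simp
  ix_x := by simp

/-- The extension of `P` applied to a family in context. -/
@[simps]
def extObj (P : Poly I J) (X : Fam.{v, u} I) : Fam.{v, u} J where
  base := X.base
  El Γ := P.Elt X Γ
  res h y := y.restrict h
  res_id y := Elt.ext' (by simp) (by simp) fun a _ _ _ =>
    Elt.x_congr (y := y) rfl (Category.comp_id a) rfl _ _
  res_comp h k y := Elt.ext' (by simp) (by simp) fun a _ _ _ =>
    Elt.x_congr (y := y) rfl (Category.assoc a h k).symm rfl _ _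
  pr y := y.d
  pr_res _ _ := rfl
  ix y := y.b ≫ P.t
  ix_res := by simp

/-- Functoriality of the extension in the family. -/
@[simps]
def extMap (P : Poly I J) {X Y : Fam.{v, u} I} (φ : FamHom X Y) :
    FamHom (P.extObj X) (P.extObj Y) where
  base := φ.base
  app y := y.push φ
  app_res _ y := Elt.ext' (Category.assoc _ y.d _) rfl fun _ _ _ _ => rfl
  pr_app _ := rfl
  ix_app _ := rfl

/-- The extension of a polynomial: a functor between categories of families, over the category of
contexts. It is the polynomial functor `Σ_t Π_p Δ_s` in every context, computed on generalised
elements: an element `Γ ⟶ Σ_t Π_p Δ_s X` is a map `b : Γ ⟶ B` together with a map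
`Γ ×_B E ⟶ X` over `I`, that is, a natural family of elements of `X` indexed by the generalised
elements `(a, m)` of `Γ ×_B E`. -/
def ext (P : Poly I J) : famCat.{v, u} I ⟶ famCat.{v, u} J where
  obj := P.extObj
  map φ := P.extMap φ
  map_id X := Fam.hom_ext rfl fun (y : P.Elt X _) =>
    Elt.ext' (Category.comp_id y.d) rfl fun _ _ _ _ => rfl
  map_comp _ _ := Fam.hom_ext rfl fun (y : P.Elt _ _) =>
    Elt.ext' (Category.assoc y.d _ _).symm rfl fun _ _ _ _ => rfl
  w := rfl

theorem isHomLift_of_base {X Y : Fam.{v, u} J} (h : X.base = Y.base) {φ : X ⟶ Y}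
    (hφ : FamHom.base φ = eqToHom h) :
    (famCat J).p.IsHomLift (𝟙 X.base) φ :=
  IsHomLift.of_fac (famCat J).p (𝟙 X.base) φ rfl h.symm
    (by change _ = eqToHom _ ≫ FamHom.base φ ≫ eqToHom _; simp [hφ])

variable {P Q R : Poly I J}

/-- The action of a transformation of extensions on elements. -/
def trApp (τ : P.ext ⟶ Q.ext) (X : Fam.{v, u} I) {Γ : C} (y : P.Elt X Γ) : Q.Elt X Γ :=
  FamHom.app (τ.toNatTrans.app X) y

theorem tr_base (τ : P.ext ⟶ Q.ext) (X : Fam.{v, u} I) :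
    FamHom.base (τ.toNatTrans.app X) = 𝟙 X.base := by
  have : (famCat J).p.IsHomLift (𝟙 X.base) (τ.toNatTrans.app X) := τ.isHomLift' X
  exact (@IsHomLift.eq_of_isHomLift _ _ _ _ (famCat J).p (P.extObj X) (Q.extObj X) (𝟙 X.base)
    (τ.toNatTrans.app X) this).symm

theorem trApp_d (τ : P.ext ⟶ Q.ext) {X : Fam.{v, u} I} {Γ : C} (y : P.Elt X Γ) :
    (trApp τ X y).d = y.d := by
  have h := FamHom.pr_app (τ.toNatTrans.app X) y
  rw [tr_base] at h
  exact h.trans (Category.comp_id y.d)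

theorem trApp_t (τ : P.ext ⟶ Q.ext) {X : Fam.{v, u} I} {Γ : C} (y : P.Elt X Γ) :
    (trApp τ X y).b ≫ Q.t = y.b ≫ P.t :=
  FamHom.ix_app (τ.toNatTrans.app X) y

theorem trApp_restrict (τ : P.ext ⟶ Q.ext) {X : Fam.{v, u} I} {Γ' Γ : C} (h : Γ' ⟶ Γ)
    (y : P.Elt X Γ) : trApp τ X (y.restrict h) = (trApp τ X y).restrict h :=
  FamHom.app_res (τ.toNatTrans.app X) h y

theorem trApp_push (τ : P.ext ⟶ Q.ext) {X Y : Fam.{v, u} I} (φ : FamHom X Y) {Γ : C}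
    (y : P.Elt X Γ) : trApp τ Y (y.push φ) = (trApp τ X y).push φ :=
  congrArg (fun ψ : FamHom (P.extObj X) (Q.extObj Y) => ψ.app y) (τ.toNatTrans.naturality φ)

theorem trApp_inj {τ τ' : P.ext ⟶ Q.ext}
    (h : ∀ (X : Fam.{v, u} I) {Γ : C} (y : P.Elt X Γ), trApp τ X y = trApp τ' X y) : τ = τ' := by
  apply BasedNatTrans.ext
  apply NatTrans.ext
  funext X
  exact Fam.hom_ext ((tr_base τ X).trans (tr_base τ' X).symm) (h X)

/-- The representable family given by `Δ ← Y → I`. -/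
@[simps]
def _root_.PolyBicat.Fam.rep {Y Δ I : C} (f : Y ⟶ Δ) (i : Y ⟶ I) : Fam.{v, u} I where
  base := Δ
  El T := ULift.{max u v} (T ⟶ Y)
  res h x := ⟨h ≫ x.down⟩
  res_id := by simp
  res_comp := by simp
  pr x := x.down ≫ f
  pr_res := by simp
  ix x := x.down ≫ i
  ix_res := by simp

variable [HasPullbacks C]

/-- A 2-cell `P ⟶ Q` of polynomials: a morphism `g : P.B ⟶ Q.B` over `J` and, on the pullback
`S = P.B ×_{Q.B} Q.E`, a morphism `e : S ⟶ P.E` over `P.B` that is compatible with the left legs.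
A diagram with an arbitrary pullback `S` in place of the chosen one is turned into such a
2-cell by `Hom.ofDiagram`. -/
structure Hom (P Q : Poly I J) where
  /-- the right-hand vertical morphism -/
  g : P.B ⟶ Q.B
  g_t : g ≫ Q.t = P.t
  /-- the upward vertical morphism -/
  e : pullback g Q.p ⟶ P.E
  e_p : e ≫ P.p = pullback.fst g Q.p
  e_s : e ≫ P.s = pullback.snd g Q.p ≫ Q.s

namespace Hom

attribute [local simp] pullback.lift_fst pullback.lift_snd pullback.lift_fst_assoc
  pullback.lift_snd_assoc

variable {P Q R : Poly I J}

/-- The 2-cell given by a diagram with middle row `S` in which the lower square, with sides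
`S ⟶ M`, `e₁ ≫ p : S ⟶ B`, `q`, `g`, is a pullback. Diagrams that differ by an isomorphism of the
objects `S` give the same 2-cell. -/
noncomputable def ofDiagram {S : C} (e₁ : S ⟶ P.E) (f₁ : S ⟶ Q.E) (g : P.B ⟶ Q.B)
    (hS : IsPullback (e₁ ≫ P.p) f₁ g Q.p) (hs : e₁ ≫ P.s = f₁ ≫ Q.s) (ht : g ≫ Q.t = P.t) :
    Hom P Q where
  g := g
  g_t := ht
  e := hS.isoPullback.inv ≫ e₁
  e_p := by simp
  e_s := by simp [hs]

/-- The morphism `e` on generalised elements. -/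
noncomputable def eAt (α : Hom P Q) {T : C} (a : T ⟶ P.B) (n : T ⟶ Q.E)
    (w : a ≫ α.g = n ≫ Q.p) : T ⟶ P.E :=
  pullback.lift a n w ≫ α.e

@[simp]
theorem eAt_p (α : Hom P Q) {T : C} (a : T ⟶ P.B) (n : T ⟶ Q.E) (w : a ≫ α.g = n ≫ Q.p) :
    α.eAt a n w ≫ P.p = a := by simp [eAt, α.e_p]

@[simp]
theorem eAt_s (α : Hom P Q) {T : C} (a : T ⟶ P.B) (n : T ⟶ Q.E) (w : a ≫ α.g = n ≫ Q.p) :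
    α.eAt a n w ≫ P.s = n ≫ Q.s := by simp [eAt, α.e_s]

theorem comp_eAt (α : Hom P Q) {T' T : C} (h : T' ⟶ T) (a : T ⟶ P.B) (n : T ⟶ Q.E)
    (w : a ≫ α.g = n ≫ Q.p) :
    h ≫ α.eAt a n w = α.eAt (h ≫ a) (h ≫ n) (by simp [w]) := by
  simp only [eAt, ← Category.assoc]
  congr 1
  ext <;> simp

theorem eAt_fst_snd (α : Hom P Q) :
    α.eAt (pullback.fst α.g Q.p) (pullback.snd α.g Q.p) pullback.condition = α.e := by
  have : pullback.lift (pullback.fst α.g Q.p) (pullback.snd α.g Q.p) pullback.condition = 𝟙 _ := by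
    ext <;> simp
  simp [eAt, this]

theorem ext' {α β : Hom P Q} (hg : α.g = β.g)
    (he : ∀ {T : C} (a : T ⟶ P.B) (n : T ⟶ Q.E) (w : a ≫ α.g = n ≫ Q.p)
      (w' : a ≫ β.g = n ≫ Q.p), α.eAt a n w = β.eAt a n w') : α = β := by
  have key := α.eAt_fst_snd
  have key' := β.eAt_fst_snd
  obtain ⟨g, h1, e, h2, h3⟩ := α
  obtain ⟨g', h1', e', h2', h3'⟩ := β
  dsimp only at hg
  subst hg
  have : e = e' := by
    exact key.symm.trans ((he _ _ pullback.condition pullback.condition).trans key')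
  subst this
  rfl

/-- The identity 2-cell. -/
noncomputable def id (P : Poly I J) : Hom P P where
  g := 𝟙 _
  g_t := by simp
  e := pullback.snd _ _
  e_p := by simp [← pullback.condition]
  e_s := rfl

/-- Vertical composition: the upward morphism of the composite is the upward morphism of `α` after
the base change of the upward morphism of `β` along the middle arrow of `α`. -/
noncomputable def comp (α : Hom P Q) (β : Hom Q R) : Hom P R where
  g := α.g ≫ β.g
  g_t := by simp [α.g_t, β.g_t]
  e := α.eAt (pullback.fst _ _)
    (β.eAt (pullback.fst _ _ ≫ α.g) (pullback.snd _ _) (by simp [pullback.condition])) (by simp)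
  e_p := by simp
  e_s := by simp

@[simp] theorem id_g (P : Poly I J) : (id P).g = 𝟙 _ := rfl

@[simp] theorem id_eAt (P : Poly I J) {T : C} (a : T ⟶ P.B) (n : T ⟶ P.E)
    (w : a ≫ (id P).g = n ≫ P.p) : (id P).eAt a n w = n := pullback.lift_snd _ _ _

@[simp] theorem comp_g (α : Hom P Q) (β : Hom Q R) : (comp α β).g = α.g ≫ β.g := rfl

@[simp] theorem comp_eAt' (α : Hom P Q) (β : Hom Q R) {T : C} (a : T ⟶ P.B) (n : T ⟶ R.E)
    (w : a ≫ (comp α β).g = n ≫ R.p) : (comp α β).eAt a n w =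
      α.eAt a (β.eAt (a ≫ α.g) n (by simpa using w)) (by simp) := by
  have w' : a ≫ α.g ≫ β.g = n ≫ R.p := w
  refine (comp_eAt α (pullback.lift a n w') _ _ _).trans ?_
  congr 1
  · simp
  · rw [comp_eAt]
    congr 1 <;> simp

end Hom

noncomputable instance : Category (Poly I J) where
  Hom := Hom
  id := Hom.id
  comp := Hom.comp
  id_comp _ := Hom.ext' (by simp) (by simp)
  comp_id _ := Hom.ext' (by simp) (by simp)
  assoc α β γ := Hom.ext' (by simp) fun a n w w' => by
    have w₁ : a ≫ (α.g ≫ β.g) ≫ γ.g = n ≫ _ := w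
    refine (Hom.comp_eAt' (Hom.comp α β) γ a n w).trans ((Hom.comp_eAt' α β a _ _).trans ?_)
    refine Eq.trans ?_ (Hom.comp_eAt' α (Hom.comp β γ) a n w').symm
    congr 1
    refine Eq.trans ?_ (Hom.comp_eAt' β γ _ n (by simpa using w₁)).symm
    congr 2
    exact (Category.assoc a α.g β.g).symm

/-! ## The action of 2-cells on extensions -/

/-- The action of a 2-cell on the elements of extensions. -/
@[simps]
noncomputable def Elt.act {P Q : Poly I J} (α : Hom P Q) {X : Fam.{v, u} I} {Γ : C}
    (y : P.Elt X Γ) : Q.Elt X Γ where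
  d := y.d
  b := y.b ≫ α.g
  x a n w := y.x a (α.eAt (a ≫ y.b) n (by simpa using w)) (by simp)
  res_x := by simp [Hom.comp_eAt]
  pr_x := by simp
  ix_x := by simp

/-- The component at a family of the transformation of extensions given by a 2-cell. -/
noncomputable def actHom {P Q : Poly I J} (α : Hom P Q) (X : Fam.{v, u} I) :
    FamHom (P.extObj X) (Q.extObj X) where
  base := 𝟙 _
  app y := y.act α
  app_res h y := Elt.ext' rfl (Category.assoc h y.b _) fun a _ _ _ =>
    Elt.x_congr (y := y) rfl rfl (by
      congr 1
      exact (Category.assoc a h y.b).symm) _ _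
  pr_app y := (Category.comp_id y.d).symm
  ix_app y := by
    change (y.b ≫ α.g) ≫ Q.t = y.b ≫ P.t
    simp [α.g_t]

/-- The transformation of extensions given by a 2-cell. -/
noncomputable def extHom {P Q : Poly I J} (α : Hom P Q) : P.ext ⟶ Q.ext where
  app X := actHom α X
  naturality _ _ φ := Fam.hom_ext
    ((Category.comp_id (FamHom.base φ)).trans (Category.id_comp (FamHom.base φ)).symm)
    fun _ => rfl
  isHomLift' X := 
    isHomLift_of_base (X := P.extObj X) (Y := Q.extObj X) rfl (φ := actHom α X) rfl

section Full

variable {P Q R : Poly I J}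

/-- The universal element of the extension of `P`. -/
@[simps]
def univ (P : Poly I J) : P.Elt (Fam.rep P.p P.s) P.B where
  d := 𝟙 _
  b := 𝟙 _
  x _ m _ := ⟨m⟩
  res_x _ _ _ _ := rfl
  pr_x _ _ w := w.symm.trans rfl
  ix_x _ _ _ := rfl

/-- The 2-cell that induces a given transformation of extensions: the value of the transformation
at the universal element. -/
noncomputable def homOfTr (τ : P.ext ⟶ Q.ext) : Hom P Q where
  g := (trApp τ _ P.univ).b
  g_t := (trApp_t τ P.univ).trans (Category.id_comp _)
  e := ((trApp τ _ P.univ).x (pullback.fst _ _) (pullback.snd _ _) pullback.condition).down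
  e_p := ((trApp τ _ P.univ).pr_x (pullback.fst _ _) (pullback.snd _ _) pullback.condition).trans
    (by rw [trApp_d]; exact Category.comp_id _)
  e_s := (trApp τ _ P.univ).ix_x (pullback.fst _ _) (pullback.snd _ _) pullback.condition

theorem homOfTr_eAt (τ : P.ext ⟶ Q.ext) {T : C} (a : T ⟶ P.B) (n : T ⟶ Q.E)
    (w : a ≫ (homOfTr τ).g = n ≫ Q.p) :
    (homOfTr τ).eAt a n w = ((trApp τ _ P.univ).x a n w).down := by
  refine (congrArg ULift.down ((trApp τ _ P.univ).res_x (pullback.lift a n w)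
    (pullback.fst _ _) (pullback.snd _ _) pullback.condition)).trans ?_
  refine congrArg ULift.down (Elt.x_congr rfl ?_ ?_ _ _)
  · exact pullback.lift_fst _ _ _
  · exact pullback.lift_snd _ _ _

theorem homOfTr_extHom (α : Hom P Q) : homOfTr (extHom α) = α := by
  have hg : (homOfTr (extHom α)).g = α.g := Category.id_comp α.g
  refine Hom.ext' hg fun a n w w' => ?_
  rw [homOfTr_eAt]
  change α.eAt (a ≫ 𝟙 _) n _ = α.eAt a n w'
  congr 1
  exact Category.comp_id a

theorem extHom_homOfTr (τ : P.ext ⟶ Q.ext) : extHom (homOfTr τ) = τ := by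
  refine trApp_inj fun X Γ y => ?_
  change y.act (homOfTr τ) = _
  -- the generic family with an element of shape `y.b` in context `Γ`
  let Z : Fam.{v, u} I := Fam.rep (pullback.fst y.b P.p) (pullback.snd y.b P.p ≫ P.s)
  let z : P.Elt Z Γ :=
    { d := 𝟙 _
      b := y.b
      x := fun a m w => ⟨pullback.lift a m w⟩
      res_x := fun h a m w => by
        apply ULift.ext
        change h ≫ pullback.lift a m w = pullback.lift (h ≫ a) (h ≫ m) _
        ext <;> simp [pullback.lift_fst, pullback.lift_snd]
      pr_x := fun a m w => (pullback.lift_fst a m w).trans (Category.comp_id a).symm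
      ix_x := fun a m w => pullback.lift_snd_assoc a m w P.s }
  let φ : FamHom Z X :=
    { base := y.d
      app := fun n => y.x (n.down ≫ pullback.fst _ _) (n.down ≫ pullback.snd _ _)
        (by simp [pullback.condition])
      app_res := fun h n => by
        rw [Elt.res_x]
        exact Elt.x_congr (y := y) rfl (Category.assoc h n.down _) (Category.assoc h n.down _) _ _
      pr_app := fun n => y.pr_x _ _ _
      ix_app := fun n => (y.ix_x _ _ _).trans (Category.assoc n.down _ _) }
  let ψ : FamHom Z (Fam.rep P.p P.s) :=
    { base := y.b
      app := fun n => ⟨n.down ≫ pullback.snd _ _⟩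
      app_res := fun h n => congrArg ULift.up (Category.assoc h n.down _)
      pr_app := fun n => by
        change (n.down ≫ pullback.snd y.b P.p) ≫ P.p = (n.down ≫ pullback.fst y.b P.p) ≫ y.b
        simp [pullback.condition]
      ix_app := fun n => Category.assoc n.down _ _ }
  have hφ : z.push φ = y := by
    refine Elt.ext' (Category.id_comp _) rfl fun a m w w' => ?_
    exact Elt.x_congr (y := y) rfl (pullback.lift_fst _ _ _) (pullback.lift_snd _ _ _) _ _
  have hψ : z.push ψ = P.univ.restrict y.b := by
    refine Elt.ext' ((Category.id_comp _).trans (Category.comp_id _).symm)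
      (Category.comp_id _).symm fun a m w w' => ?_
    exact congrArg ULift.up (pullback.lift_snd _ _ _)
  have h₁ : (trApp τ Z z).push ψ = (trApp τ _ P.univ).restrict y.b := by
    rw [← trApp_push, hψ, trApp_restrict]
  have h₂ : trApp τ X y = (trApp τ Z z).push φ := by
    rw [← trApp_push, hφ]
  rw [h₂]
  have hb : (trApp τ Z z).b = y.b ≫ (homOfTr τ).g := congrArg Elt.b h₁
  refine Elt.ext' (congrArg Elt.d h₂ ▸ (trApp_d τ y).symm) hb.symm fun a n w w' => ?_
  change y.x a _ _ = y.x _ _ _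
  refine Elt.x_congr (y := y) rfl ?_ ?_ _ _
  · have := (trApp τ Z z).pr_x a n w'
    rw [trApp_d] at this
    exact (this.trans (Category.comp_id a)).symm
  · have h₃ : a ≫ ((trApp τ _ P.univ).restrict y.b).b = n ≫ Q.p := by rw [← h₁]; exact w'
    have := congrArg ULift.down (Elt.x_congr h₁ (rfl : a = a) (rfl : n = n) w' h₃)
    refine Eq.trans ?_ this.symm
    exact homOfTr_eAt τ _ _ _

/-- The extension as a functor from polynomials and their 2-cells. -/
noncomputable def extFunctor (I J : C) : Poly I J ⥤ (famCat.{v, u} I ⟶ famCat.{v, u} J) where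
  obj P := P.ext
  map α := extHom α
  map_id P := trApp_inj fun X Γ y => Elt.ext' rfl (Category.comp_id y.b) fun a m w w' =>
    Elt.x_congr (y := y) rfl rfl (Hom.id_eAt P _ _ _) _ _
  map_comp α β := trApp_inj fun X Γ y => Elt.ext' rfl (Category.assoc y.b α.g β.g).symm
    fun a m w w' => by
      refine Elt.x_congr (y := y) rfl rfl ((Hom.comp_eAt' α β _ _ _).trans ?_) _ _
      congr 2
      exact Category.assoc a y.b α.g

/-- 2-cells of polynomials are the same as transformations of their extensions. -/
noncomputable def extFullyFaithful (I J : C) : (extFunctor.{v, u} I J).FullyFaithful where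
  preimage τ := homOfTr τ
  map_preimage τ := extHom_homOfTr τ
  preimage_map α := homOfTr_extHom α

end Full

end Poly

/-! ## Distributivity pullbacks -/

/-- Local cartesian closure: every pullback functor `Δ_f` between slices has a right adjoint. -/
class LocallyCartesianClosed (C : Type u) [Category.{v} C] [HasPullbacks C] : Prop where
  isLeftAdjoint_pullback : ∀ {X Y : C} (f : X ⟶ Y), (Over.pullback f).IsLeftAdjoint

attribute [instance] LocallyCartesianClosed.isLeftAdjoint_pullback

variable [HasPullbacks C] [LocallyCartesianClosed C]

/-- The pushforward `Π_f`, right adjoint to pullback along `f`. -/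
noncomputable def pushforward {X Y : C} (f : X ⟶ Y) : Over X ⥤ Over Y :=
  (Over.pullback f).rightAdjoint

/-- The adjunction `Δ_f ⊣ Π_f`. -/
noncomputable def pushforwardAdj {X Y : C} (f : X ⟶ Y) : Over.pullback f ⊣ pushforward f :=
  Adjunction.ofIsLeftAdjoint _

section Dist

variable {B J M N : C} (t : B ⟶ J) (w : M ⟶ J) (q : M ⟶ N)

/-- The object `Π_q (B ×_J M)` over `N`, the lower left corner of the distributivity pullback around
`q` and the projection `B ×_J M ⟶ M`. -/
noncomputable def dist : Over N := (pushforward q).obj (Over.mk (pullback.snd t w))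

/-- The upper side `N' ×_N M ⟶ B ×_J M` of the distributivity pullback (where `N'` is `dist`). -/
noncomputable def distCounit : pullback (dist t w q).hom q ⟶ pullback t w :=
  ((pushforwardAdj q).counit.app (Over.mk (pullback.snd t w))).left

theorem distCounit_snd : distCounit t w q ≫ pullback.snd t w = pullback.snd _ _ :=
  Over.w ((pushforwardAdj q).counit.app (Over.mk (pullback.snd t w)))

/-- The morphism `distCounit` followed by the projection to `B`. -/
noncomputable def distEv : pullback (dist t w q).hom q ⟶ B := distCounit t w q ≫ pullback.fst _ _

theorem distEv_t : distEv t w q ≫ t = pullback.snd _ _ ≫ w := by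
  rw [distEv, Category.assoc, pullback.condition, ← Category.assoc, distCounit_snd]

variable {t w q}

/-- The value of `distEv` at a generalised element. -/
noncomputable def evAt {T : C} (f : T ⟶ (dist t w q).left) (n : T ⟶ M)
    (h : f ≫ (dist t w q).hom = n ≫ q) : T ⟶ B :=
  pullback.lift f n h ≫ distEv t w q

@[simp]
theorem evAt_t {T : C} (f : T ⟶ (dist t w q).left) (n : T ⟶ M)
    (h : f ≫ (dist t w q).hom = n ≫ q) : evAt f n h ≫ t = n ≫ w := by
  rw [evAt, Category.assoc, distEv_t, pullback.lift_snd_assoc]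

theorem comp_evAt {T' T : C} (k : T' ⟶ T) (f : T ⟶ (dist t w q).left) (n : T ⟶ M)
    (h : f ≫ (dist t w q).hom = n ≫ q) :
    k ≫ evAt f n h = evAt (k ≫ f) (k ≫ n) (by simp [h]) := by
  simp only [evAt, ← Category.assoc]
  congr 1
  ext <;> simp [pullback.lift_fst, pullback.lift_snd]

/-- The universal property of `dist`: existence. -/
noncomputable def distLiftOver {Γ : C} (c : Γ ⟶ N) (b : pullback c q ⟶ B)
    (hb : b ≫ t = pullback.snd _ _ ≫ w) : Over.mk c ⟶ dist t w q :=
  (pushforwardAdj q).homEquiv (Over.mk c) (Over.mk (pullback.snd t w))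
    (Over.homMk (pullback.lift b (pullback.snd _ _) hb) (pullback.lift_snd _ _ _))

/-- The morphism to `dist` that corresponds to `b`. -/
noncomputable def distLift {Γ : C} (c : Γ ⟶ N) (b : pullback c q ⟶ B)
    (hb : b ≫ t = pullback.snd _ _ ≫ w) : Γ ⟶ (dist t w q).left := (distLiftOver c b hb).left

@[simp]
theorem distLift_hom {Γ : C} (c : Γ ⟶ N) (b : pullback c q ⟶ B)
    (hb : b ≫ t = pullback.snd _ _ ≫ w) : distLift c b hb ≫ (dist t w q).hom = c :=
  Over.w (distLiftOver c b hb)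

theorem homEquiv_symm_fst {Γ : C} (c : Γ ⟶ N) (f : Over.mk c ⟶ dist t w q) :
    (((pushforwardAdj q).homEquiv (Over.mk c) (Over.mk (pullback.snd t w))).symm f).left ≫
      pullback.fst _ _ = evAt (pullback.fst c q ≫ f.left) (pullback.snd c q) (by
        rw [Category.assoc, Over.w f]; exact pullback.condition) := by
  refine (congrArg (fun z => CommaMorphism.left z ≫ pullback.fst t w)
    ((pushforwardAdj q).homEquiv_counit (g := f))).trans ?_
  change (((Over.pullback q).map f).left ≫ distCounit t w q) ≫ pullback.fst t w =
    _ ≫ (distCounit t w q ≫ pullback.fst _ _)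
  rw [← Category.assoc]
  congr 2

theorem evAt_distLift {Γ : C} (c : Γ ⟶ N) (b : pullback c q ⟶ B)
    (hb : b ≫ t = pullback.snd _ _ ≫ w) {T : C} (a : T ⟶ Γ) (n : T ⟶ M)
    (h : (a ≫ distLift c b hb) ≫ (dist t w q).hom = n ≫ q) (h' : a ≫ c = n ≫ q) :
    evAt (a ≫ distLift c b hb) n h = pullback.lift a n h' ≫ b := by
  have key := homEquiv_symm_fst c (distLiftOver c b hb)
  rw [distLiftOver, Equiv.symm_apply_apply] at key
  have key' : b = evAt (pullback.fst c q ≫ distLift c b hb) (pullback.snd c q)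
      (by simp [pullback.condition]) := (pullback.lift_fst _ _ hb).symm.trans key
  conv_rhs => rw [key']
  rw [comp_evAt]
  congr 1
  · simp [pullback.lift_fst_assoc]
  · simp [pullback.lift_snd]

/-- The universal property of `dist`: uniqueness. -/
theorem dist_hom_ext {Γ : C} {f f' : Γ ⟶ (dist t w q).left}
    (h : f ≫ (dist t w q).hom = f' ≫ (dist t w q).hom)
    (h' : ∀ {T : C} (a : T ⟶ Γ) (n : T ⟶ M) (k : (a ≫ f) ≫ (dist t w q).hom = n ≫ q)
      (k' : (a ≫ f') ≫ (dist t w q).hom = n ≫ q), evAt (a ≫ f) n k = evAt (a ≫ f') n k') :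
    f = f' := by
  let F : Over.mk (f ≫ (dist t w q).hom) ⟶ dist t w q := Over.homMk f
  let F' : Over.mk (f ≫ (dist t w q).hom) ⟶ dist t w q := Over.homMk f' h.symm
  have : F = F' := by
    apply ((pushforwardAdj q).homEquiv _ (Over.mk (pullback.snd t w))).symm.injective
    apply Over.OverMorphism.ext
    apply pullback.hom_ext
    · rw [homEquiv_symm_fst, homEquiv_symm_fst]
      exact h' _ _ _ _
    · exact (Over.w (((pushforwardAdj q).homEquiv _ (Over.mk (pullback.snd t w))).symm F)).trans
        (Over.w (((pushforwardAdj q).homEquiv _ (Over.mk (pullback.snd t w))).symm F')).symm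
  exact congrArg CommaMorphism.left this

end Dist

namespace Poly

variable {I J K : C}

/-! ## Composition of polynomials -/

/-- The identity polynomial. -/
@[reducible] def one (I : C) : Poly I I where
  E := I
  B := I
  s := 𝟙 I
  p := 𝟙 I
  t := 𝟙 I

/-- The composite of `P : I ⟶ J` and `Q : J ⟶ K`, formed with a pullback, a distributivity pullback
and two further pullbacks. -/
@[reducible] noncomputable def cmp (P : Poly I J) (Q : Poly J K) : Poly I K where
  E := pullback P.p (distEv P.t Q.s Q.p)
  B := (dist P.t Q.s Q.p).left
  s := pullback.fst _ _ ≫ P.s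
  p := pullback.snd _ _ ≫ pullback.fst _ _
  t := (dist P.t Q.s Q.p).hom ≫ Q.t

section CmpE

variable {P : Poly I J} {Q : Poly J K}

/-- A generalised element of the middle object of a composite polynomial. -/
noncomputable def cmpLift {T : C} (m : T ⟶ P.E) (f : T ⟶ (dist P.t Q.s Q.p).left) (n : T ⟶ Q.E)
    (h : f ≫ (dist P.t Q.s Q.p).hom = n ≫ Q.p) (w : evAt f n h = m ≫ P.p) : T ⟶ (P.cmp Q).E :=
  pullback.lift m (pullback.lift f n h) w.symm

theorem cmpLift_fst {T : C} (m : T ⟶ P.E) (f : T ⟶ (dist P.t Q.s Q.p).left) (n : T ⟶ Q.E)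
    (h : f ≫ (dist P.t Q.s Q.p).hom = n ≫ Q.p) (w : evAt f n h = m ≫ P.p) :
    cmpLift m f n h w ≫ pullback.fst _ _ = m := pullback.lift_fst _ _ _

theorem cmpLift_p {T : C} (m : T ⟶ P.E) (f : T ⟶ (dist P.t Q.s Q.p).left) (n : T ⟶ Q.E)
    (h : f ≫ (dist P.t Q.s Q.p).hom = n ≫ Q.p) (w : evAt f n h = m ≫ P.p) :
    cmpLift m f n h w ≫ (P.cmp Q).p = f :=
  (pullback.lift_snd_assoc _ _ _ _).trans (pullback.lift_fst _ _ _)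

theorem cmpLift_snd_snd {T : C} (m : T ⟶ P.E) (f : T ⟶ (dist P.t Q.s Q.p).left) (n : T ⟶ Q.E)
    (h : f ≫ (dist P.t Q.s Q.p).hom = n ≫ Q.p) (w : evAt f n h = m ≫ P.p) :
    cmpLift m f n h w ≫ pullback.snd _ _ ≫ pullback.snd _ _ = n :=
  (pullback.lift_snd_assoc _ _ _ _).trans (pullback.lift_snd _ _ _)

theorem cmp_hom_ext {T : C} {k k' : T ⟶ (P.cmp Q).E}
    (h₁ : k ≫ pullback.fst _ _ = k' ≫ pullback.fst _ _)
    (h₂ : k ≫ (P.cmp Q).p = k' ≫ (P.cmp Q).p)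
    (h₃ : k ≫ pullback.snd _ _ ≫ pullback.snd _ _ = k' ≫ pullback.snd _ _ ≫ pullback.snd _ _) :
    k = k' := by
  apply pullback.hom_ext h₁
  apply pullback.hom_ext
  · exact (Category.assoc _ _ _).trans (h₂.trans (Category.assoc _ _ _).symm)
  · exact (Category.assoc _ _ _).trans (h₃.trans (Category.assoc _ _ _).symm)

theorem comp_cmpLift {T' T : C} (l : T' ⟶ T) (m : T ⟶ P.E) (f : T ⟶ (dist P.t Q.s Q.p).left)
    (n : T ⟶ Q.E) (h : f ≫ (dist P.t Q.s Q.p).hom = n ≫ Q.p) (w : evAt f n h = m ≫ P.p) :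
    l ≫ cmpLift m f n h w = cmpLift (l ≫ m) (l ≫ f) (l ≫ n) (by simp [h])
      (by rw [← comp_evAt l f n h, w, Category.assoc]) := by
  apply cmp_hom_ext
  · rw [Category.assoc, cmpLift_fst, cmpLift_fst]
  · rw [Category.assoc, cmpLift_p, cmpLift_p]
  · rw [Category.assoc, cmpLift_snd_snd, cmpLift_snd_snd]

theorem cmp_w {T : C} (k : T ⟶ (P.cmp Q).E) : (k ≫ (P.cmp Q).p) ≫ (dist P.t Q.s Q.p).hom =
    (k ≫ pullback.snd P.p (distEv P.t Q.s Q.p) ≫ pullback.snd _ _) ≫ Q.p := by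
  simp [pullback.condition]

theorem cmp_w' {T : C} (k : T ⟶ (P.cmp Q).E) :
    evAt (k ≫ (P.cmp Q).p) (k ≫ pullback.snd P.p (distEv P.t Q.s Q.p) ≫ pullback.snd _ _)
      (cmp_w k) = (k ≫ pullback.fst P.p (distEv P.t Q.s Q.p)) ≫ P.p := by
  rw [Category.assoc, pullback.condition]
  refine Eq.trans (congrArg (· ≫ distEv P.t Q.s Q.p) ?_) (Category.assoc k _ _)
  apply pullback.hom_ext
  · rw [pullback.lift_fst, Category.assoc]
  · rw [pullback.lift_snd, Category.assoc]

end CmpE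

/-- An element of the extension of a composite is an element of the composite of the extensions. -/
noncomputable def Elt.uncomp {P : Poly I J} {Q : Poly J K} {X : Fam.{v, u} I} {Γ : C}
    (y : (P.cmp Q).Elt X Γ) : Q.Elt (P.extObj X) Γ where
  d := y.d
  b := y.b ≫ (dist P.t Q.s Q.p).hom
  x {T} a n w :=
    { d := a ≫ y.d
      b := evAt (a ≫ y.b) n ((Category.assoc _ _ _).trans w)
      x := fun {T'} a' m w' => y.x (a' ≫ a)
        (cmpLift m ((a' ≫ a) ≫ y.b) (a' ≫ n)
          (by
            refine (Category.assoc (a' ≫ a) y.b _).trans ((Category.assoc a' a _).trans ?_)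
            rw [w, Category.assoc])
          (by
            rw [← w', comp_evAt]
            congr 1
            exact Category.assoc a' a y.b))
        (cmpLift_p _ _ _ _ _).symm
      res_x := fun h a' m w' => by
        rw [Elt.res_x]
        refine Elt.x_congr rfl (Category.assoc _ _ _).symm ?_ _ _
        rw [comp_cmpLift]
        congr 1
        · exact ((Category.assoc (h ≫ a') a y.b).trans ((Category.assoc h a' _).trans
            (congrArg (h ≫ ·) (Category.assoc a' a y.b).symm))).symm.trans
              (congrArg (· ≫ y.b) rfl)
        · exact (Category.assoc h a' n).symm
      pr_x := by simp
      ix_x := fun a' m w' => by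
        rw [Elt.ix_x]
        exact pullback.lift_fst_assoc _ _ _ _ }
  res_x h a n w := by
    refine Elt.ext' (Category.assoc h a y.d).symm ?_ fun a' m w₁ w₂ => ?_
    · refine (comp_evAt _ _ _ _).trans ?_
      congr 1
      exact (Category.assoc h a y.b).symm
    · refine Elt.x_congr (y := y) rfl (Category.assoc a' h a) ?_ _ _
      congr 1
      · exact congrArg (· ≫ y.b) (Category.assoc a' h a)
      · exact Category.assoc a' h n
  pr_x _ _ _ := rfl
  ix_x a n w := evAt_t _ _ _

theorem Elt.b_eq {P : Poly I J} {Q : Poly J K} {X : Fam.{v, u} I} {Γ : C}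
    (z : Q.Elt (P.extObj X) Γ) {T : C} (a : T ⟶ Γ) (n : T ⟶ Q.E) (w : a ≫ z.b = n ≫ Q.p) :
    pullback.lift a n w ≫
      Elt.b (z.x (pullback.fst z.b Q.p) (pullback.snd z.b Q.p) pullback.condition) =
        Elt.b (z.x a n w) :=
  (congrArg Elt.b (z.res_x (pullback.lift a n w) _ _ _)).trans
    (congrArg Elt.b (Elt.x_congr (y := z) rfl (pullback.lift_fst _ _ _)
      (pullback.lift_snd _ _ _) _ _))

/-- The shape of an element of the extension of a composite. -/
noncomputable def Elt.shape {P : Poly I J} {Q : Poly J K} {X : Fam.{v, u} I} {Γ : C}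
    (z : Q.Elt (P.extObj X) Γ) : Γ ⟶ (dist P.t Q.s Q.p).left :=
  distLift z.b (Elt.b (z.x (pullback.fst _ _) (pullback.snd _ _) pullback.condition))
    (z.ix_x _ _ _)

theorem Elt.shape_hom {P : Poly I J} {Q : Poly J K} {X : Fam.{v, u} I} {Γ : C}
    (z : Q.Elt (P.extObj X) Γ) : z.shape ≫ (dist P.t Q.s Q.p).hom = z.b :=
  distLift_hom _ _ _

theorem Elt.evAt_shape {P : Poly I J} {Q : Poly J K} {X : Fam.{v, u} I} {Γ : C}
    (z : Q.Elt (P.extObj X) Γ) {T : C} (a : T ⟶ Γ) (n : T ⟶ Q.E)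
    (h : (a ≫ z.shape) ≫ (dist P.t Q.s Q.p).hom = n ≫ Q.p) (w : a ≫ z.b = n ≫ Q.p) :
    evAt (a ≫ z.shape) n h = Elt.b (z.x a n w) :=
  (evAt_distLift _ _ _ _ _ _ w).trans (z.b_eq a n w)

/-- Equal elements have equal components over equal arguments (iterated version). -/
theorem Elt.xx_congr {P : Poly I J} {Q : Poly J K} {X : Fam.{v, u} I} {Γ : C}
    (z : Q.Elt (P.extObj X) Γ) {T T' : C} {a : T ⟶ Γ} {n : T ⟶ Q.E} {w : a ≫ z.b = n ≫ Q.p}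
    {a' : T' ⟶ Γ} {n' : T' ⟶ Q.E} {w' : a' ≫ z.b = n' ≫ Q.p} (h : T' ⟶ T) (ha : h ≫ a = a')
    (hn : h ≫ n = n') {m m' : T' ⟶ P.E} (hm : m = m') (k : h ≫ Elt.b (z.x a n w) = m ≫ P.p)
    (k' : 𝟙 T' ≫ Elt.b (z.x a' n' w') = m' ≫ P.p) :
    Elt.x (P := P) (z.x a n w) h m k = Elt.x (P := P) (z.x a' n' w') (𝟙 T') m' k' := by
  subst ha hn hm
  have e : Elt.restrict h (z.x a n w) = z.x (h ≫ a) (h ≫ n) w' := z.res_x h a n w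
  refine Eq.trans ?_ (Elt.x_congr e rfl rfl ?_ k')
  · exact Elt.x_congr (y := z.x a n w) rfl (Category.id_comp h).symm rfl _ _
  · exact (Category.id_comp _).trans k

/-- An element of the composite of the extensions is an element of the extension of the
composite. -/
noncomputable def Elt.recomp {P : Poly I J} {Q : Poly J K} {X : Fam.{v, u} I} {Γ : C}
    (z : Q.Elt (P.extObj X) Γ) : (P.cmp Q).Elt X Γ where
  d := z.d
  b := z.shape
  x {T} a k w := Elt.x (P := P)
    (z.x a (k ≫ pullback.snd P.p (distEv P.t Q.s Q.p) ≫ pullback.snd _ _) (by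
      rw [← cmp_w, ← w, Category.assoc, z.shape_hom])) (𝟙 T)
      (k ≫ pullback.fst P.p (distEv P.t Q.s Q.p)) (by
      rw [Category.id_comp, ← cmp_w', ← z.evAt_shape]
      · congr 1
      · rw [Category.assoc, z.shape_hom, ← cmp_w, ← w, Category.assoc, z.shape_hom])
  res_x h a k w := by
    refine (Elt.res_x _ _ _ _ _).trans ?_
    exact z.xx_congr (h ≫ 𝟙 _) (by simp) (by simp) (by simp) _ _
  pr_x a k w := by
    refine (Elt.pr_x _ _ _ _).trans ((Category.id_comp _).trans ?_)
    exact z.pr_x _ _ _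
  ix_x a k w := (Elt.ix_x _ _ _ _).trans (Category.assoc _ _ _)

theorem Elt.recomp_uncomp {P : Poly I J} {Q : Poly J K} {X : Fam.{v, u} I} {Γ : C}
    (y : (P.cmp Q).Elt X Γ) : y.uncomp.recomp = y := by
  have hb : y.uncomp.shape = y.b := by
    apply dist_hom_ext
    · exact y.uncomp.shape_hom
    · intro T a n k k'
      exact y.uncomp.evAt_shape a n k ((Category.assoc _ _ _).symm.trans k')
  refine Elt.ext' rfl hb fun {T} a k w w' => ?_
  refine Elt.x_congr (y := y) rfl (Category.id_comp a) ?_ _ _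
  apply cmp_hom_ext
  · rw [cmpLift_fst]
  · rw [cmpLift_p, Category.id_comp, w']
  · rw [cmpLift_snd_snd, Category.id_comp]

theorem Elt.uncomp_recomp {P : Poly I J} {Q : Poly J K} {X : Fam.{v, u} I} {Γ : C}
    (z : Q.Elt (P.extObj X) Γ) : z.recomp.uncomp = z := by
  refine Elt.ext' rfl z.shape_hom fun {T} a n w w' => ?_
  refine Elt.ext' (z.pr_x a n w').symm (z.evAt_shape a n _ w') fun {T'} a' m k k' => ?_
  have hk : 𝟙 T' ≫ Elt.b (z.x (a' ≫ a) (a' ≫ n) (by rw [Category.assoc, w', Category.assoc])) =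
      m ≫ P.p := by
    rw [Category.id_comp, ← k']
    exact (congrArg Elt.b (z.res_x a' a n w')).symm
  refine Eq.trans ?_ (z.xx_congr (w := w') a' rfl rfl rfl k' hk).symm
  refine z.xx_congr (𝟙 _) (Category.id_comp _) ?_ ?_ _ _
  · rw [cmpLift_snd_snd, Category.id_comp]
  · rw [cmpLift_fst]

theorem Elt.uncomp_restrict {P : Poly I J} {Q : Poly J K} {X : Fam.{v, u} I} {Γ' Γ : C}
    (h : Γ' ⟶ Γ) (y : (P.cmp Q).Elt X Γ) : (y.restrict h).uncomp = y.uncomp.restrict h := by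
  refine Elt.ext' rfl (Category.assoc _ _ _) fun {T} a n w w' => ?_
  refine Elt.ext' (Category.assoc a h y.d).symm ?_ fun {T'} a' m k k' => ?_
  · change evAt (a ≫ h ≫ y.b) n _ = evAt ((a ≫ h) ≫ y.b) n _
    congr 1
    exact (Category.assoc a h y.b).symm
  · refine Elt.x_congr (y := y) rfl (Category.assoc a' a h) ?_ _ _
    congr 1
    change (a' ≫ a) ≫ h ≫ y.b = (a' ≫ a ≫ h) ≫ y.b
    simp

theorem Elt.uncomp_push {P : Poly I J} {Q : Poly J K} {X Y : Fam.{v, u} I} (φ : FamHom X Y) {Γ : C}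
    (y : (P.cmp Q).Elt X Γ) : (y.push φ).uncomp = y.uncomp.push (P.extMap φ) :=
  Elt.ext' rfl rfl fun a _ _ _ =>
    Elt.ext' (Category.assoc a y.d _).symm rfl fun _ _ _ _ => rfl

theorem Elt.recomp_restrict {P : Poly I J} {Q : Poly J K} {X : Fam.{v, u} I} {Γ' Γ : C}
    (h : Γ' ⟶ Γ) (z : Q.Elt (P.extObj X) Γ) : (z.restrict h).recomp = z.recomp.restrict h := by
  have := Elt.uncomp_restrict h z.recomp
  rw [Elt.uncomp_recomp] at this
  rw [← this, Elt.recomp_uncomp]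

theorem Elt.recomp_push {P : Poly I J} {Q : Poly J K} {X Y : Fam.{v, u} I} (φ : FamHom X Y) {Γ : C}
    (z : Q.Elt (P.extObj X) Γ) : (z.push (P.extMap φ)).recomp = z.recomp.push φ := by
  have := Elt.uncomp_push φ z.recomp
  rw [Elt.uncomp_recomp] at this
  rw [← this, Elt.recomp_uncomp]

/-- The extension of a composite is the composite of the extensions. -/
noncomputable def extCmp (P : Poly I J) (Q : Poly J K) :
    (P.cmp Q).ext ≅ (P.ext ≫ Q.ext : famCat.{v, u} I ⟶ famCat.{v, u} K) where
  hom :=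
    { app := fun X =>
        ({ base := 𝟙 _
           app := fun y => y.uncomp
           app_res := fun h y => Elt.uncomp_restrict h y
           pr_app := fun y => (Category.comp_id y.d).symm
           ix_app := fun y => Category.assoc _ _ _ } :
          FamHom ((P.cmp Q).extObj X) (Q.extObj (P.extObj X)))
      naturality := fun _ _ φ => Fam.hom_ext
        ((Category.comp_id (FamHom.base φ)).trans (Category.id_comp (FamHom.base φ)).symm)
        fun y => Elt.uncomp_push φ y
      isHomLift' := fun X =>
        isHomLift_of_base (X := (P.cmp Q).extObj X) (Y := Q.extObj (P.extObj X)) rfl rfl }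
  inv :=
    { app := fun X =>
        ({ base := 𝟙 _
           app := fun y => y.recomp
           app_res := fun h y => Elt.recomp_restrict h y
           pr_app := fun y => (Category.comp_id y.d).symm
           ix_app := fun y =>
             (Category.assoc _ _ _).symm.trans (congrArg (· ≫ Q.t) y.shape_hom) } :
          FamHom (Q.extObj (P.extObj X)) ((P.cmp Q).extObj X))
      naturality := fun _ _ φ => Fam.hom_ext
        ((Category.comp_id (FamHom.base φ)).trans (Category.id_comp (FamHom.base φ)).symm)
        fun z => Elt.recomp_push φ z
      isHomLift' := fun X =>
        isHomLift_of_base (X := Q.extObj (P.extObj X)) (Y := (P.cmp Q).extObj X) rfl rfl }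
  hom_inv_id := by
    apply BasedNatTrans.ext
    apply NatTrans.ext
    funext X
    exact Fam.hom_ext (Category.comp_id _) fun y => Elt.recomp_uncomp y
  inv_hom_id := by
    apply BasedNatTrans.ext
    apply NatTrans.ext
    funext X
    exact Fam.hom_ext (Category.comp_id _) fun y => Elt.uncomp_recomp y

/-- The extension of the identity polynomial is the identity. -/
noncomputable def extOne (I : C) : (one I).ext ≅ 𝟙 (famCat.{v, u} I) where
  hom :=
    { app := fun X =>
        ({ base := 𝟙 _
           app := fun {T} y => y.x (𝟙 T) y.b ((Category.id_comp _).trans (Category.comp_id _).symm)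
           app_res := fun h y => by
             refine Eq.trans ?_ (y.res_x _ _ _ _).symm
             exact Elt.x_congr (y := y) rfl
               ((Category.id_comp h).trans (Category.comp_id h).symm) rfl _ _
           pr_app := fun y => (y.pr_x _ _ _).trans
             ((Category.id_comp y.d).trans (Category.comp_id y.d).symm)
           ix_app := fun y => y.ix_x _ _ _ } : FamHom ((one I).extObj X) X)
      naturality := fun _ _ φ => Fam.hom_ext
        ((Category.comp_id (FamHom.base φ)).trans (Category.id_comp (FamHom.base φ)).symm)
        fun _ => rfl
      isHomLift' := fun X => isHomLift_of_base (X := (one I).extObj X) (Y := X) rfl rfl }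
  inv :=
    { app := fun X =>
        ({ base := 𝟙 _
           app := fun {T} x =>
             { d := X.pr x
               b := X.ix x
               x := fun a _ _ => X.res a x
               res_x := by simp
               pr_x := by simp
               ix_x := fun a m w => by
                 rw [X.ix_res]
                 exact w }
           app_res := fun h x => Elt.ext' (X.pr_res h x) (X.ix_res h x) fun _ _ _ _ =>
             (X.res_comp _ _ _).symm
           pr_app := fun x => (Category.comp_id (X.pr x)).symm
           ix_app := fun x => Category.comp_id (X.ix x) } : FamHom X ((one I).extObj X))
      naturality := fun X Y φ => Fam.hom_ext
        ((Category.comp_id (FamHom.base φ)).trans (Category.id_comp (FamHom.base φ)).symm)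
        fun x => Elt.ext' (FamHom.pr_app φ x) (FamHom.ix_app φ x) fun a _ _ _ =>
          (FamHom.app_res φ a x).symm
      isHomLift' := fun X => isHomLift_of_base (X := X) (Y := (one I).extObj X) rfl rfl }
  hom_inv_id := by
    apply BasedNatTrans.ext
    apply NatTrans.ext
    funext X
    refine Fam.hom_ext (Category.comp_id _) fun (y : (one I).Elt X _) => ?_
    refine Elt.ext' ((y.pr_x _ _ _).trans (Category.id_comp _))
      ((y.ix_x _ _ _).trans (Category.comp_id _)) fun a m w w' => ?_
    refine (y.res_x _ _ _ _).trans (Elt.x_congr (y := y) rfl (Category.comp_id a) ?_ _ _)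
    exact w'.trans (Category.comp_id m)
  inv_hom_id := by
    apply BasedNatTrans.ext
    apply NatTrans.ext
    funext X
    exact Fam.hom_ext (Category.comp_id _) fun x => X.res_id x

end Poly

/-! ## The bicategory of polynomials -/

/-- The objects of the bicategory of polynomials in `C`: those of `C`. -/
structure PolyObj (C : Type u) where
  /-- the underlying object -/
  as : C

/-- The bicategory `Poly(C)` of polynomials in `C` with general 2-cells. Objects, 1-cells, their
composites, 2-cells and their vertical composites are the ones defined above. The horizontal
composition of 2-cells, the associators and the unitors are the ones given by the identification
of 2-cells of polynomials with the natural transformations, fibred over the contexts (that is,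
strong), between the corresponding polynomial functors. -/
noncomputable instance polyBicategory : Bicategory (PolyObj C) :=
  transportBicategory (fun I => famCat.{v, u} I.as) (fun I J => Poly I.as J.as)
    (fun I J => Poly.extFunctor I.as J.as) (fun I J => Poly.extFullyFaithful I.as J.as)
    (fun I => Poly.one I.as) (fun P Q => P.cmp Q)
    (fun P Q => Poly.extCmp P Q) (fun I => Poly.extOne I.as)

/-! ## Polynomials that represent a composite -/

namespace Poly

variable {I J K : C} {P : Poly I J} {Q : Poly J K}

/-- The right-hand component of `Poly.toCmp`. -/
noncomputable def toCmpBase {A B : C} (m₁ : A ⟶ P.B) (m₂ : A ⟶ Q.E) (b : A ⟶ B) (r : B ⟶ Q.B)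
    (right : IsPullback m₂ b Q.p r) (mid : m₁ ≫ P.t = m₂ ≫ Q.s) : B ⟶ (P.cmp Q).B :=
  distLift r (right.lift (pullback.snd r Q.p) (pullback.fst r Q.p) pullback.condition.symm ≫ m₁)
    (by rw [Category.assoc, mid, IsPullback.lift_fst_assoc])

theorem toCmp_w {A B : C} (m₁ : A ⟶ P.B) (m₂ : A ⟶ Q.E) (b : A ⟶ B) (r : B ⟶ Q.B)
    (right : IsPullback m₂ b Q.p r) (mid : m₁ ≫ P.t = m₂ ≫ Q.s) {T : C} (h : T ⟶ B)
    (k : T ⟶ (P.cmp Q).E) (w : h ≫ toCmpBase m₁ m₂ b r right mid = k ≫ (P.cmp Q).p) :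
    (k ≫ pullback.snd P.p (distEv P.t Q.s Q.p) ≫ pullback.snd _ _) ≫ Q.p = h ≫ r := by
  rw [← cmp_w, ← w, toCmpBase, Category.assoc, distLift_hom]

theorem toCmp_w' {A B : C} (m₁ : A ⟶ P.B) (m₂ : A ⟶ Q.E) (b : A ⟶ B) (r : B ⟶ Q.B)
    (right : IsPullback m₂ b Q.p r) (mid : m₁ ≫ P.t = m₂ ≫ Q.s) {T : C} (h : T ⟶ B)
    (k : T ⟶ (P.cmp Q).E) (w : h ≫ toCmpBase m₁ m₂ b r right mid = k ≫ (P.cmp Q).p) :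
    (k ≫ pullback.fst P.p (distEv P.t Q.s Q.p)) ≫ P.p =
      right.lift _ h (toCmp_w m₁ m₂ b r right mid h k w) ≫ m₁ := by
  have h₁ := toCmp_w m₁ m₂ b r right mid h k w
  have h₂ : (h ≫ toCmpBase m₁ m₂ b r right mid) ≫ (dist P.t Q.s Q.p).hom =
      (k ≫ pullback.snd P.p (distEv P.t Q.s Q.p) ≫ pullback.snd _ _) ≫ Q.p := by
    rw [w, cmp_w]
  have h₃ : evAt (h ≫ toCmpBase m₁ m₂ b r right mid) _ h₂ =
      (k ≫ pullback.fst P.p (distEv P.t Q.s Q.p)) ≫ P.p := by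
    rw [← cmp_w']
    congr 1
  rw [← h₃]
  refine (evAt_distLift _ _ _ _ _ h₂ h₁.symm).trans ?_
  rw [← Category.assoc]
  congr 1
  apply right.hom_ext <;> simp [pullback.lift_fst, pullback.lift_snd]

/-- Suppose that a polynomial `R : I ⟶ K` is presented as the outside of a commuting diagram
```
          R.E --a--> A --b--> R.B
         l |     m₁ / \ m₂     | r
          P.E --> P.B  Q.E --> Q.B
```
over `P : I ⟶ J` and `Q : J ⟶ K` in which the left and the right squares are pullbacks (and the
middle square `m₁ ≫ P.t = m₂ ≫ Q.s` commutes). This is the canonical 2-cell from `R` to the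
composite of `P` and `Q`: the unique map to the composite, which is terminal among such diagrams. -/
noncomputable def toCmp (R : Poly I K) {A : C}
    (l : R.E ⟶ P.E) (a : R.E ⟶ A) (m₁ : A ⟶ P.B) (m₂ : A ⟶ Q.E) (b : A ⟶ R.B) (r : R.B ⟶ Q.B)
    (left : IsPullback l a P.p m₁) (right : IsPullback m₂ b Q.p r) (mid : m₁ ≫ P.t = m₂ ≫ Q.s)
    (hs : R.s = l ≫ P.s) (hp : R.p = a ≫ b) (ht : R.t = r ≫ Q.t) : Poly.Hom R (P.cmp Q) where
  g := toCmpBase m₁ m₂ b r right mid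
  g_t := by rw [ht, toCmpBase, ← Category.assoc, distLift_hom]
  e := left.lift (pullback.snd _ (P.cmp Q).p ≫ pullback.fst P.p (distEv P.t Q.s Q.p))
    (right.lift _ (pullback.fst _ (P.cmp Q).p)
      (toCmp_w m₁ m₂ b r right mid _ (pullback.snd _ (P.cmp Q).p) pullback.condition))
    (toCmp_w' m₁ m₂ b r right mid _ (pullback.snd _ (P.cmp Q).p) pullback.condition)
  e_p := by rw [hp, IsPullback.lift_snd_assoc, IsPullback.lift_snd]
  e_s := by rw [hs, IsPullback.lift_fst_assoc, Category.assoc]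

end Poly

/-! ## The basic adjunctions -/

section Adjunctions

variable {X Y : C} (f : X ⟶ Y)

/-- The 1-cell `(1, 1, f) : X ⟶ Y`. -/
def sigma : (⟨X⟩ : PolyObj C) ⟶ ⟨Y⟩ := (⟨X, X, 𝟙 X, 𝟙 X, f⟩ : Poly X Y)

/-- The 1-cell `(f, 1, 1) : Y ⟶ X`. -/
def delta : (⟨Y⟩ : PolyObj C) ⟶ ⟨X⟩ := (⟨X, X, f, 𝟙 X, 𝟙 X⟩ : Poly Y X)

/-- The 1-cell `(1, f, 1) : X ⟶ Y`. -/
def pi : (⟨X⟩ : PolyObj C) ⟶ ⟨Y⟩ := (⟨X, Y, 𝟙 X, f, 𝟙 Y⟩ : Poly X Y)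

/-- The diagonal `X ⟶ X ×_Y X`. -/
noncomputable def diag : X ⟶ pullback f f := pullback.lift (𝟙 X) (𝟙 X) rfl

@[simp]
theorem diag_fst : diag f ≫ pullback.fst f f = 𝟙 X := pullback.lift_fst _ _ _

@[simp]
theorem diag_snd : diag f ≫ pullback.snd f f = 𝟙 X := pullback.lift_snd _ _ _

/-- The polynomial `(π₁, 1, π₂) : X ⟶ X`, where `π₁ π₂ : X ×_Y X ⟶ X` are the projections. -/
noncomputable def sigmaDelta : (⟨X⟩ : PolyObj C) ⟶ ⟨X⟩ :=
  (⟨pullback f f, pullback f f, pullback.fst f f, 𝟙 _, pullback.snd f f⟩ : Poly X X)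

/-- The polynomial `(f, 1, f) : Y ⟶ Y`. -/
def deltaSigma : (⟨Y⟩ : PolyObj C) ⟶ ⟨Y⟩ := (⟨X, X, f, 𝟙 X, f⟩ : Poly Y Y)

/-- The polynomial `(f, f, 1) : Y ⟶ Y`. -/
def deltaPi : (⟨Y⟩ : PolyObj C) ⟶ ⟨Y⟩ := (⟨X, Y, f, f, 𝟙 Y⟩ : Poly Y Y)

/-- The polynomial `(π₁, π₂, 1) : X ⟶ X`, where `π₁ π₂ : X ×_Y X ⟶ X` are the projections. -/
noncomputable def piDelta : (⟨X⟩ : PolyObj C) ⟶ ⟨X⟩ :=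
  (⟨pullback f f, X, pullback.fst f f, pullback.snd f f, 𝟙 X⟩ : Poly X X)

/-- The canonical 2-cell from `(π₁, 1, π₂)` to the composite `(1, 1, f)` then `(f, 1, 1)`. -/
noncomputable def sigmaDeltaComp : sigmaDelta f ⟶ sigma f ≫ delta f :=
  Poly.toCmp (P := ⟨X, X, 𝟙 X, 𝟙 X, f⟩) (Q := ⟨X, X, f, 𝟙 X, 𝟙 X⟩)
    ⟨pullback f f, pullback f f, pullback.fst f f, 𝟙 _, pullback.snd f f⟩
    (A := pullback f f) (pullback.fst f f) (𝟙 _) (pullback.fst f f) (pullback.snd f f) (𝟙 _)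
    (pullback.snd f f) (IsPullback.of_vert_isIso ⟨by simp⟩) (IsPullback.of_vert_isIso ⟨by simp⟩)
    pullback.condition (by simp) (by simp) (by simp)

/-- The canonical 2-cell from `(f, 1, f)` to the composite `(f, 1, 1)` then `(1, 1, f)`. -/
noncomputable def deltaSigmaComp : deltaSigma f ⟶ delta f ≫ sigma f :=
  Poly.toCmp (P := ⟨X, X, f, 𝟙 X, 𝟙 X⟩) (Q := ⟨X, X, 𝟙 X, 𝟙 X, f⟩)
    ⟨X, X, f, 𝟙 X, f⟩ (A := X) (𝟙 X) (𝟙 X) (𝟙 X) (𝟙 X) (𝟙 X) (𝟙 X)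
    (IsPullback.of_vert_isIso ⟨by simp⟩) (IsPullback.of_vert_isIso ⟨by simp⟩)
    rfl (by simp) (by simp) (by simp)

/-- The canonical 2-cell from `(f, f, 1)` to the composite `(f, 1, 1)` then `(1, f, 1)`. -/
noncomputable def deltaPiComp : deltaPi f ⟶ delta f ≫ pi f :=
  Poly.toCmp (P := ⟨X, X, f, 𝟙 X, 𝟙 X⟩) (Q := ⟨X, Y, 𝟙 X, f, 𝟙 Y⟩)
    ⟨X, Y, f, f, 𝟙 Y⟩ (A := X) (𝟙 X) (𝟙 X) (𝟙 X) (𝟙 X) f (𝟙 Y)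
    (IsPullback.of_vert_isIso ⟨by simp⟩) (IsPullback.of_horiz_isIso ⟨by simp⟩)
    rfl (by simp) (by simp) (by simp)

/-- The canonical 2-cell from `(π₁, π₂, 1)` to the composite `(1, f, 1)` then `(f, 1, 1)`. -/
noncomputable def piDeltaComp : piDelta f ⟶ pi f ≫ delta f :=
  Poly.toCmp (P := ⟨X, Y, 𝟙 X, f, 𝟙 Y⟩) (Q := ⟨X, X, f, 𝟙 X, 𝟙 X⟩)
    ⟨pullback f f, X, pullback.fst f f, pullback.snd f f, 𝟙 X⟩ (A := X)
    (pullback.fst f f) (pullback.snd f f) f (𝟙 X) (𝟙 X) (𝟙 X)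
    (IsPullback.of_hasPullback f f) (IsPullback.of_vert_isIso ⟨by simp⟩)
    (by simp) (by simp) (by simp) (by simp)

/-- The diagram `X = X ⟶ X ×_Y X` (with right-hand side `X ⟶ X ×_Y X`), a 2-cell from the
identity to `(π₁, 1, π₂)`. -/
noncomputable def sigmaUnit : 𝟙 (⟨X⟩ : PolyObj C) ⟶ sigmaDelta f :=
  Poly.Hom.ofDiagram (P := Poly.one X)
    (Q := ⟨pullback f f, pullback f f, pullback.fst f f, 𝟙 _, pullback.snd f f⟩)
    (S := X) (𝟙 X) (diag f) (diag f) (IsPullback.of_horiz_isIso ⟨by simp⟩) (by simp) (by simp)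

/-- The diagram `X = X ⟶ Y` (with right-hand side `f : X ⟶ Y`), a 2-cell from `(f, 1, f)` to the
identity. -/
noncomputable def sigmaCounit : deltaSigma f ⟶ 𝟙 (⟨Y⟩ : PolyObj C) :=
  Poly.Hom.ofDiagram (P := ⟨X, X, f, 𝟙 X, f⟩) (Q := Poly.one Y)
    (S := X) (𝟙 X) f f (IsPullback.of_horiz_isIso ⟨by simp⟩) (by simp) (by simp)

/-- The diagram `Y ⟵ X = X` (with right-hand side `Y = Y`), a 2-cell from the identity to
`(f, f, 1)`. -/
noncomputable def piUnit : 𝟙 (⟨Y⟩ : PolyObj C) ⟶ deltaPi f :=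
  Poly.Hom.ofDiagram (P := Poly.one Y) (Q := ⟨X, Y, f, f, 𝟙 Y⟩)
    (S := X) f (𝟙 X) (𝟙 Y) (IsPullback.of_vert_isIso ⟨by simp⟩) (by simp) (by simp)

/-- The diagram `X ×_Y X ⟵ X = X` (with right-hand side `X = X`), a 2-cell from `(π₁, π₂, 1)` to
the identity. -/
noncomputable def piCounit : piDelta f ⟶ 𝟙 (⟨X⟩ : PolyObj C) :=
  Poly.Hom.ofDiagram
    (P := ⟨pullback f f, X, pullback.fst f f, pullback.snd f f, 𝟙 X⟩) (Q := Poly.one X)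
    (S := X) (diag f) (𝟙 X) (𝟙 X) (IsPullback.of_vert_isIso ⟨by simp⟩) (by simp) (by simp)

end Adjunctions

end PolyBicat

open PolyBicat
open scoped CategoryTheory.Bicategory

/-! For (1) and (2) the units and counits are prescribed, so once the comparison 2-cells are known
to be invertible only the triangle identities remain. After cancelling unitors, each of them equates
two endo-2-cells of `sigma f`, `delta f` or `pi f`. In these 1-cells two of the three arrows are
identities, and this forces every endo-2-cell to be the identity (`sigma_hom_ext`, `delta_hom_ext`,
`pi_hom_ext`). No horizontal composite has to be computed.

The comparison 2-cells are handled by the criterion that a 2-cell is invertible when both `g` and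
`e` are (`Hom.isIso`). For a canonical map into a composite, `e` is always invertible
(`isIso_toCmp_e`); `g` is invertible when the distributivity pullback degenerates.

For (3) the essential point is that the middle arrow `p` of a left adjoint `L` is invertible
(`isIso_of_adjunction`). One triangle identity is transported to extensions and read on generalised
elements. The unit is a 2-cell out of an identity polynomial, so its value at `x` has only
restrictions of `x` as components. The counit is a 2-cell into an identity polynomial, so it reads
off a component at a single position `n`. Together they say that every element of the extension of
`L` is constant, with value its component at some `n` (`elt_eq_res_of_adjunction`). The universal
element has `m` itself as its component at `m`; being constant, it makes `n` an inverse of `p`.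
Hence `L` is of the form `delta g ≫ sigma f`, and uniqueness of right adjoints (`exists_iso_right`)
determines `R`, the unit and the counit. -/

namespace CategoryTheory.Bicategory.Adjunction

universe w₁ v₁ u₁

variable {B : Type u₁} [Bicategory.{w₁, v₁} B] {a b : B} {l₁ l₂ : a ⟶ b} {r₁ r₂ : b ⟶ a}

/-! ### Conjugate 2-cells and uniqueness of right adjoints. -/

/-- The conjugate of a 2-cell between left adjoints is compatible with the units. -/
theorem unit_conjugateEquiv (adj₁ : Adjunction l₁ r₁) (adj₂ : Adjunction l₂ r₂) (α : l₂ ⟶ l₁) :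
    adj₁.unit ≫ l₁ ◁ conjugateEquiv adj₁ adj₂ α = adj₂.unit ≫ α ▷ r₂ := by
  rw [conjugateEquiv_apply']
  calc
    _ = 𝟙 _ ⊗≫ (adj₁.unit ▷ 𝟙 a ≫ (l₁ ≫ r₁) ◁ (adj₂.unit ≫ α ▷ r₂)) ⊗≫
          l₁ ◁ adj₁.counit ▷ r₂ ⊗≫ 𝟙 _ := by
      bicategory
    _ = 𝟙 _ ⊗≫ (adj₂.unit ≫ α ▷ r₂) ⊗≫ leftZigzag adj₁.unit adj₁.counit ▷ r₂ ⊗≫ 𝟙 _ := by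
      -- Interchange moves `adj₁.unit` past `adj₂.unit ≫ α ▷ r₂`, so that it meets `adj₁.counit` and
      -- forms a zigzag.
      rw [← whisker_exchange]; bicategory
    _ = _ := by
      rw [adj₁.left_triangle]; bicategory

/-- The conjugate of a 2-cell between left adjoints is compatible with the counits. -/
theorem conjugateEquiv_counit (adj₁ : Adjunction l₁ r₁) (adj₂ : Adjunction l₂ r₂) (α : l₂ ⟶ l₁) :
    conjugateEquiv adj₁ adj₂ α ▷ l₂ ≫ adj₂.counit = r₁ ◁ α ≫ adj₁.counit := by
  rw [conjugateEquiv_apply']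
  calc
    _ = 𝟙 _ ⊗≫ r₁ ◁ adj₂.unit ▷ l₂ ⊗≫
          ((r₁ ◁ α ≫ adj₁.counit) ▷ (r₂ ≫ l₂) ≫ 𝟙 b ◁ adj₂.counit) ⊗≫ 𝟙 _ := by
      bicategory
    _ = 𝟙 _ ⊗≫ r₁ ◁ leftZigzag adj₂.unit adj₂.counit ⊗≫ (r₁ ◁ α ≫ adj₁.counit) ⊗≫ 𝟙 _ := by
      rw [← whisker_exchange]; bicategory
    _ = _ := by
      rw [adj₂.left_triangle]; bicategory

/-- Isomorphic 1-cells have isomorphic right adjoints, compatibly with the units and counits. -/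
theorem exists_iso_right (adj₁ : Adjunction l₁ r₁) (adj₂ : Adjunction l₂ r₂) (φ : l₁ ≅ l₂) :
    ∃ ψ : r₁ ≅ r₂, adj₁.unit ≫ φ.hom ▷ r₁ ≫ l₂ ◁ ψ.hom = adj₂.unit ∧
      adj₁.counit = ψ.hom ▷ l₁ ≫ r₂ ◁ φ.hom ≫ adj₂.counit := by
  refine ⟨conjugateIsoEquiv adj₁ adj₂ φ.symm, ?_, ?_⟩
  · change _ ≫ _ ≫ l₂ ◁ conjugateEquiv adj₁ adj₂ φ.inv = _
    -- The conjugate is that of `φ.inv`; with the conjugate applied first, the unit lemma yields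
    -- `φ.inv ▷ r₂`, which cancels `φ.hom ▷ r₂`.
    rw [← whisker_exchange, ← Category.assoc, unit_conjugateEquiv]
    simp
  · change _ = conjugateEquiv adj₁ adj₂ φ.inv ▷ l₁ ≫ _
    rw [← whisker_exchange_assoc, conjugateEquiv_counit]
    simp

end CategoryTheory.Bicategory.Adjunction

namespace PolyBicat

variable {C : Type u} [Category.{v} C]

/-! ### Invertible 2-cells and invertible comparisons with composites. -/

namespace Poly

section

variable {I J : C} [HasPullbacks C] {P Q : Poly I J}

theorem Hom.eAt_snd_inv (α : Hom P Q) [IsIso α.e] {T : C} (a : T ⟶ P.B) (n : T ⟶ Q.E)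
    (w : a ≫ α.g = n ≫ Q.p) : (α.eAt a n w ≫ inv α.e) ≫ pullback.snd α.g Q.p = n := by
  simp [Hom.eAt, pullback.lift_snd]

/-- The inverse of a 2-cell both of whose components are invertible. -/
noncomputable def Hom.symm (α : Hom P Q) [IsIso α.g] [IsIso α.e] : Hom Q P where
  g := inv α.g
  g_t := by simp [← α.g_t]
  e := pullback.snd (inv α.g) P.p ≫ inv α.e ≫ pullback.snd α.g Q.p
  e_p := by
    have : inv α.e ≫ pullback.fst α.g Q.p = P.p := by simp [← α.e_p]
    rw [Category.assoc, Category.assoc, ← pullback.condition, reassoc_of% this,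
      ← pullback.condition_assoc]
    simp
  e_s := by simp [← α.e_s]

theorem Hom.symm_eAt (α : Hom P Q) [IsIso α.g] [IsIso α.e] {T : C} (a : T ⟶ Q.B) (n : T ⟶ P.E)
    (w : a ≫ α.symm.g = n ≫ P.p) :
    α.symm.eAt a n w = n ≫ inv α.e ≫ pullback.snd α.g Q.p :=
  pullback.lift_snd_assoc _ _ _ _

theorem Hom.isIso (α : P ⟶ Q) (hg : IsIso (Hom.g α)) (he : IsIso (Hom.e α)) : IsIso α := by
  refine ⟨Hom.symm α, ?_, ?_⟩
  · refine Hom.ext' (IsIso.hom_inv_id (Hom.g α)) fun a n w w' => ?_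
    refine (Hom.comp_eAt' α (Hom.symm α) a n w).trans (Eq.trans ?_ (Hom.id_eAt P a n w').symm)
    have w'' : a = n ≫ P.p := (Category.comp_id a).symm.trans w'
    -- Transporting along `inv e` turns an equation in `P.E` into one in the pullback of `g` and
    -- `Q.p`, where the two projections can be compared separately.
    rw [← cancel_mono (inv (Hom.e α))]
    apply pullback.hom_ext
    · have h : inv (Hom.e α) ≫ pullback.fst (Hom.g α) Q.p = P.p := by simp [← Hom.e_p]
      refine (Category.assoc _ _ _).trans ((congrArg (_ ≫ ·) h).trans ?_)
      rw [Hom.eAt_p, Category.assoc, h, w'']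
    · rw [Hom.eAt_snd_inv, Hom.symm_eAt, Category.assoc]
  · refine Hom.ext' (IsIso.inv_hom_id (Hom.g α)) fun a n w w' => ?_
    refine (Hom.comp_eAt' (Hom.symm α) α a n w).trans (Eq.trans ?_ (Hom.id_eAt Q a n w').symm)
    rw [Hom.symm_eAt, ← Category.assoc, Hom.eAt_snd_inv]

end

variable [HasPullbacks C] [LocallyCartesianClosed C] {I J K : C} {P : Poly I J} {Q : Poly J K}

section ToCmp

variable {A B : C} {m₁ : A ⟶ P.B} {m₂ : A ⟶ Q.E} {b : A ⟶ B} {r : B ⟶ Q.B}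

/-- The beta rule for `toCmpBase`, which is a transpose under `Δ ⊣ Π`, with the chosen pullback
replaced by the given square `right`. -/
theorem evAt_toCmpBase (right : IsPullback m₂ b Q.p r) (mid : m₁ ≫ P.t = m₂ ≫ Q.s) {T : C}
    (h : T ⟶ B) (n : T ⟶ Q.E)
    (w : (h ≫ toCmpBase m₁ m₂ b r right mid) ≫ (dist P.t Q.s Q.p).hom = n ≫ Q.p)
    (w' : n ≫ Q.p = h ≫ r) :
    evAt (h ≫ toCmpBase m₁ m₂ b r right mid) n w = right.lift n h w' ≫ m₁ := by
  refine (evAt_distLift _ _ _ _ _ w w'.symm).trans ?_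
  rw [← Category.assoc]
  congr 1
  apply right.hom_ext <;> simp [pullback.lift_fst, pullback.lift_snd]

theorem toCmpBase_hom (right : IsPullback m₂ b Q.p r) (mid : m₁ ≫ P.t = m₂ ≫ Q.s) :
    toCmpBase m₁ m₂ b r right mid ≫ (dist P.t Q.s Q.p).hom = r := distLift_hom _ _ _

/-- Pushforward along an isomorphism changes nothing, so `dist` is essentially the pullback of `P.t`
and `Q.s`, that is `A`; and `b`, a base change of `Q.p`, identifies `A` with `B`. -/
theorem isIso_toCmpBase_of_isPullback [IsIso Q.p] (right : IsPullback m₂ b Q.p r)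
    (mid : IsPullback m₁ m₂ P.t Q.s) : IsIso (toCmpBase m₁ m₂ b r right mid.w) := by
  have hb : IsIso b := right.isIso_snd_of_isIso
  let D : Over Q.B := dist P.t Q.s Q.p
  -- The only position over `D.hom`; evaluation there, paired with `n`, gives the map `k` to `A`.
  let n : D.left ⟶ Q.E := D.hom ≫ inv Q.p
  have hn : 𝟙 D.left ≫ D.hom = n ≫ Q.p := by simp [n]
  let k : D.left ⟶ A := mid.lift (evAt (𝟙 _) n hn) n (evAt_t _ _ _)
  refine ⟨k ≫ b, ?_, ?_⟩
  · rw [← Category.assoc, ← IsIso.eq_comp_inv, Category.id_comp]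
    apply mid.hom_ext
    · have h₂ : (toCmpBase m₁ m₂ b r right mid.w ≫ n) ≫ Q.p = 𝟙 _ ≫ r := by
        simp [n, D, toCmpBase_hom]
      have h₃ : (𝟙 _ ≫ toCmpBase m₁ m₂ b r right mid.w) ≫ D.hom =
          (toCmpBase m₁ m₂ b r right mid.w ≫ n) ≫ Q.p := by
        simp [n]
      rw [Category.assoc, mid.lift_fst, comp_evAt]
      refine Eq.trans ?_ ((evAt_toCmpBase right mid.w (𝟙 _) _ h₃ h₂).trans ?_)
      · congr 1
        exact (Category.comp_id _).trans (Category.id_comp _).symm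
      · congr 1
        rw [← cancel_mono b, right.lift_snd, IsIso.inv_hom_id]
    · rw [Category.assoc, mid.lift_snd, ← cancel_mono Q.p]
      simp [n, D, toCmpBase_hom, right.w]
  · have h₁ : (k ≫ b) ≫ r = D.hom := by
      rw [Category.assoc, ← right.w, mid.lift_snd_assoc]
      simp [n]
    apply dist_hom_ext
    · rw [Category.assoc, toCmpBase_hom, h₁, Category.id_comp]
    · intro T a n' h h'
      have h₂ : a ≫ D.hom = n' ≫ Q.p := by simpa using h'
      have h₃ : n' ≫ Q.p = (a ≫ k ≫ b) ≫ r := by rw [Category.assoc, h₁, h₂]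
      have h₄ : right.lift n' (a ≫ k ≫ b) h₃ = a ≫ k := by
        rw [← cancel_mono b, right.lift_snd, Category.assoc]
      have h₅ : a ≫ n = n' := by
        rw [← cancel_mono Q.p, ← h₂]
        simp [n]
      refine Eq.trans ?_ ((evAt_toCmpBase right mid.w (a ≫ k ≫ b) n' (by simpa using h) h₃).trans
        ?_)
      · congr 1
        simp only [Category.assoc]
      · rw [h₄, Category.assoc, mid.lift_fst, comp_evAt]
        congr 1

/-- When `P.t` is monic, a map into `dist` is determined by its projection to `Q.B`; since `r` is
invertible, `toCmpBase` provides a section of that projection up to `r`. -/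
theorem isIso_toCmpBase_of_mono [Mono P.t] [IsIso r] (right : IsPullback m₂ b Q.p r)
    (mid : m₁ ≫ P.t = m₂ ≫ Q.s) : IsIso (toCmpBase m₁ m₂ b r right mid) := by
  refine ⟨(dist P.t Q.s Q.p).hom ≫ inv r, ?_, ?_⟩
  · rw [← Category.assoc, toCmpBase_hom, IsIso.hom_inv_id]
  · apply dist_hom_ext
    · simp [toCmpBase_hom]
    · intro T a n k k'
      rw [← cancel_mono P.t, evAt_t, evAt_t]

end ToCmp

/-- A generalised element of the pullback of `(P.cmp Q).p` along `toCmpBase` amounts to an element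
of `R.B`, a position in `Q.E` over it, and a position in `P.E` over the evaluated shape. By `right`
the first two form an element of `A`, and by `left` the third completes it to an element of `R.E`.
The inverse `z` sends an element of `R.E` to these data. -/
theorem isIso_toCmp_e (R : Poly I K) {A : C} {l : R.E ⟶ P.E} {a : R.E ⟶ A} {m₁ : A ⟶ P.B}
    {m₂ : A ⟶ Q.E} {b : A ⟶ R.B} {r : R.B ⟶ Q.B}
    (left : IsPullback l a P.p m₁) (right : IsPullback m₂ b Q.p r) (mid : m₁ ≫ P.t = m₂ ≫ Q.s)
    (hs : R.s = l ≫ P.s) (hp : R.p = a ≫ b) (ht : R.t = r ≫ Q.t) :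
    IsIso (toCmp R l a m₁ m₂ b r left right mid hs hp ht).e := by
  have h' : (a ≫ m₂) ≫ Q.p = R.p ≫ r := by
    rw [hp, Category.assoc, Category.assoc, right.w]
  have h : (R.p ≫ toCmpBase m₁ m₂ b r right mid) ≫ (dist P.t Q.s Q.p).hom =
      (a ≫ m₂) ≫ Q.p := by
    rw [Category.assoc, toCmpBase_hom, h']
  have w : evAt (R.p ≫ toCmpBase m₁ m₂ b r right mid) (a ≫ m₂) h = l ≫ P.p := by
    rw [evAt_toCmpBase right mid _ _ h h', left.w]
    congr 1
    apply right.hom_ext <;> simp [hp]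
  let g := toCmpBase m₁ m₂ b r right mid
  let e : pullback g (P.cmp Q).p ⟶ R.E := (toCmp R l a m₁ m₂ b r left right mid hs hp ht).e
  have e_p : e ≫ R.p = pullback.fst _ _ := Hom.e_p _
  have e_l : e ≫ l = pullback.snd _ _ ≫ pullback.fst _ _ := left.lift_fst _ _ _
  have e_a : (e ≫ a) ≫ m₂ = pullback.snd _ _ ≫ pullback.snd _ _ ≫ pullback.snd _ _ :=
    (congrArg (· ≫ m₂) (left.lift_snd _ _ _)).trans (right.lift_fst _ _ _)
  let z : R.E ⟶ pullback g (P.cmp Q).p :=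
    pullback.lift R.p (cmpLift l _ _ h w) (cmpLift_p _ _ _ _ _).symm
  have z_fst : z ≫ pullback.fst _ _ = R.p := pullback.lift_fst _ _ _
  have z_snd : z ≫ pullback.snd _ _ = cmpLift l _ _ h w := pullback.lift_snd _ _ _
  change IsIso e
  refine ⟨z, ?_, ?_⟩
  · apply pullback.hom_ext
    · rw [Category.assoc, z_fst, e_p, Category.id_comp]
    · rw [Category.assoc, z_snd, Category.id_comp, comp_cmpLift]
      apply cmp_hom_ext
      · rw [cmpLift_fst, e_l]
      · rw [cmpLift_p, ← Category.assoc, e_p]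
        exact pullback.condition
      · rw [cmpLift_snd_snd, ← Category.assoc, e_a]
  · apply left.hom_ext
    · rw [Category.assoc, Category.id_comp, e_l, ← Category.assoc, z_snd, cmpLift_fst]
    · rw [Category.id_comp]
      apply right.hom_ext
      · rw [Category.assoc, Category.assoc, ← Category.assoc e, e_a, ← Category.assoc, z_snd,
          cmpLift_snd_snd]
      · rw [Category.assoc, Category.assoc, ← hp, e_p, z_fst]

theorem isIso_toCmp_of_isPullback [IsIso Q.p] (R : Poly I K) {A : C} {l : R.E ⟶ P.E} {a : R.E ⟶ A}
    {m₁ : A ⟶ P.B} {m₂ : A ⟶ Q.E} {b : A ⟶ R.B} {r : R.B ⟶ Q.B}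
    (left : IsPullback l a P.p m₁) (right : IsPullback m₂ b Q.p r) (mid : IsPullback m₁ m₂ P.t Q.s)
    (hs : R.s = l ≫ P.s) (hp : R.p = a ≫ b) (ht : R.t = r ≫ Q.t) :
    IsIso (X := R) (Y := P.cmp Q) (toCmp R l a m₁ m₂ b r left right mid.w hs hp ht) :=
  Hom.isIso _ (isIso_toCmpBase_of_isPullback right mid) (isIso_toCmp_e R left right mid.w hs hp ht)

theorem isIso_toCmp_of_mono [Mono P.t] (R : Poly I K) {A : C} {l : R.E ⟶ P.E} {a : R.E ⟶ A}
    {m₁ : A ⟶ P.B} {m₂ : A ⟶ Q.E} {b : A ⟶ R.B} {r : R.B ⟶ Q.B} [IsIso r]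
    (left : IsPullback l a P.p m₁) (right : IsPullback m₂ b Q.p r) (mid : m₁ ≫ P.t = m₂ ≫ Q.s)
    (hs : R.s = l ≫ P.s) (hp : R.p = a ≫ b) (ht : R.t = r ≫ Q.t) :
    IsIso (X := R) (Y := P.cmp Q) (toCmp R l a m₁ m₂ b r left right mid hs hp ht) :=
  Hom.isIso _ (isIso_toCmpBase_of_mono right mid) (isIso_toCmp_e R left right mid hs hp ht)

end Poly

/-! ### The two basic families of adjunctions. -/

section Adjunctions

variable [HasPullbacks C] [LocallyCartesianClosed C] {X Y : C} (f : X ⟶ Y)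

instance isIso_sigmaDeltaComp : IsIso (sigmaDeltaComp f) :=
  Poly.isIso_toCmp_of_isPullback (P := ⟨X, X, 𝟙 X, 𝟙 X, f⟩) (Q := ⟨X, X, f, 𝟙 X, 𝟙 X⟩)
    ⟨pullback f f, pullback f f, pullback.fst f f, 𝟙 _, pullback.snd f f⟩ _ _
    (IsPullback.of_hasPullback f f) _ _ _

instance isIso_deltaSigmaComp : IsIso (deltaSigmaComp f) :=
  Poly.isIso_toCmp_of_isPullback (P := ⟨X, X, f, 𝟙 X, 𝟙 X⟩) (Q := ⟨X, X, 𝟙 X, 𝟙 X, f⟩)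
    ⟨X, X, f, 𝟙 X, f⟩ _ _ (IsPullback.of_vert_isIso ⟨rfl⟩) _ _ _

/-- Here `Q.p` is `f`, which need not be invertible, so the criterion for monic `P.t` is used, with
`P.t` and `r` identities. -/
instance isIso_deltaPiComp : IsIso (deltaPiComp f) :=
  Poly.isIso_toCmp_of_mono (P := ⟨X, X, f, 𝟙 X, 𝟙 X⟩) (Q := ⟨X, Y, 𝟙 X, f, 𝟙 Y⟩)
    ⟨X, Y, f, f, 𝟙 Y⟩ _ _ _ _ _ _

instance isIso_piDeltaComp : IsIso (piDeltaComp f) :=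
  Poly.isIso_toCmp_of_isPullback (P := ⟨X, Y, 𝟙 X, f, 𝟙 Y⟩) (Q := ⟨X, X, f, 𝟙 X, 𝟙 X⟩)
    ⟨pullback f f, X, pullback.fst f f, pullback.snd f f, 𝟙 X⟩ _ _
    (IsPullback.of_vert_isIso ⟨by simp⟩) _ _ _

/-- Since `p` and `s` are identities, `e` equals both projections of the pullback of `g` and `𝟙`.
These therefore agree, and cancelling the first, a base change of an identity and hence epi, gives
`g = 𝟙`. -/
theorem sigma_hom_ext (α β : sigma f ⟶ sigma f) : α = β := by
  have h (α : Poly.Hom (⟨X, X, 𝟙 X, 𝟙 X, f⟩ : Poly X Y) ⟨X, X, 𝟙 X, 𝟙 X, f⟩) : α.g = 𝟙 X := by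
    have h₁ := α.e_p.symm.trans α.e_s
    have h₂ := pullback.condition (f := α.g) (g := 𝟙 X)
    rw [← h₁] at h₂
    exact (cancel_epi (pullback.fst α.g (𝟙 X))).1 (h₂.trans (Category.comp_id _).symm)
  refine Poly.Hom.ext' ((h α).trans (h β).symm) fun a n w w' => ?_
  exact (Category.comp_id _).symm.trans ((Poly.Hom.eAt_p α a n w).trans
    ((Poly.Hom.eAt_p β a n w').symm.trans (Category.comp_id _)))

/-- The trivial right leg fixes `g`, and the trivial middle arrow fixes `e`. -/
theorem delta_hom_ext (α β : delta f ⟶ delta f) : α = β := by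
  have h (α : Poly.Hom (⟨X, X, f, 𝟙 X, 𝟙 X⟩ : Poly Y X) ⟨X, X, f, 𝟙 X, 𝟙 X⟩) : α.g = 𝟙 X :=
    (Category.comp_id _).symm.trans α.g_t
  refine Poly.Hom.ext' ((h α).trans (h β).symm) fun a n w w' => ?_
  exact (Category.comp_id _).symm.trans ((Poly.Hom.eAt_p α a n w).trans
    ((Poly.Hom.eAt_p β a n w').symm.trans (Category.comp_id _)))

/-- The trivial right leg fixes `g`; this time the trivial left leg fixes `e`. -/
theorem pi_hom_ext (α β : pi f ⟶ pi f) : α = β := by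
  have h (α : Poly.Hom (⟨X, Y, 𝟙 X, f, 𝟙 Y⟩ : Poly X Y) ⟨X, Y, 𝟙 X, f, 𝟙 Y⟩) : α.g = 𝟙 Y :=
    (Category.comp_id _).symm.trans α.g_t
  refine Poly.Hom.ext' ((h α).trans (h β).symm) fun a n w w' => ?_
  exact (Category.comp_id _).symm.trans ((Poly.Hom.eAt_s α a n w).trans
    ((Poly.Hom.eAt_s β a n w').symm.trans (Category.comp_id _)))

open Bicategory

/-- The adjunction `Σ_f ⊣ Δ_f`. -/
noncomputable def sigmaAdj : Bicategory.Adjunction (sigma f) (delta f) where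
  unit := sigmaUnit f ≫ sigmaDeltaComp f
  counit := inv (deltaSigmaComp f) ≫ sigmaCounit f
  left_triangle := by
    -- Composing with unitors turns both sides into endo-2-cells of `sigma f`, of which there is
    -- only one.
    rw [← cancel_mono (ρ_ (sigma f)).hom, ← cancel_epi (λ_ (sigma f)).inv]
    exact sigma_hom_ext f _ _
  right_triangle := by
    rw [← cancel_mono (λ_ (delta f)).hom, ← cancel_epi (ρ_ (delta f)).inv]
    exact delta_hom_ext f _ _

/-- The adjunction `Δ_f ⊣ Π_f`. -/
noncomputable def piAdj : Bicategory.Adjunction (delta f) (pi f) where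
  unit := piUnit f ≫ deltaPiComp f
  counit := inv (piDeltaComp f) ≫ piCounit f
  left_triangle := by
    rw [← cancel_mono (ρ_ (delta f)).hom, ← cancel_epi (λ_ (delta f)).inv]
    exact delta_hom_ext f _ _
  right_triangle := by
    rw [← cancel_mono (λ_ (pi f)).hom, ← cancel_epi (ρ_ (pi f)).inv]
    exact pi_hom_ext f _ _

end Adjunctions

end PolyBicat

namespace PolyBicat

variable {C : Type u} [Category.{v} C] [HasPullbacks C] [LocallyCartesianClosed C]

/-! ### The middle arrow of a left adjoint is invertible. -/

section Adjoint

open Bicategory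

variable {I J : PolyObj C} {L : I ⟶ J} {R : J ⟶ I}

theorem leftZigzag_eq {B : Type*} [Bicategory B] {a b : B} {l : a ⟶ b} {r : b ⟶ a}
    (η : 𝟙 a ⟶ l ≫ r) (θ : r ≫ l ⟶ 𝟙 b) :
    leftZigzag η θ = η ▷ l ≫ (α_ l r l).hom ≫ l ◁ θ := by
  simp [leftZigzag, bicategoricalComp]

/-- Pseudofunctors preserve triangle identities: `h` is the image of one, with the structure 2-cells
expanded through the constraints, and the `mᵢ` cancel. The 1-cells `i`, `j`, `lr`, `rl` and `pᵢ`
stand for images of identities and composites. -/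
theorem leftZigzag_of_comparison {B : Type*} [Bicategory B] {a b : B} {l p₁ p₂ p₃ p₄ : a ⟶ b}
    {r : b ⟶ a} {i lr : a ⟶ a} {j rl : b ⟶ b} (ι : i ≅ 𝟙 a) (κ : j ≅ 𝟙 b) (μ : lr ≅ l ≫ r)
    (ν : rl ≅ r ≫ l) (m₁ : p₁ ≅ i ≫ l) (m₂ : p₂ ≅ lr ≫ l) (m₃ : p₃ ≅ l ≫ rl) (m₄ : p₄ ≅ l ≫ j)
    (η : i ⟶ lr) (θ : rl ⟶ j)
    (h : (m₁.hom ≫ η ▷ l ≫ m₂.inv) ≫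
      (m₂.hom ≫ μ.hom ▷ l ≫ (α_ l r l).hom ≫ l ◁ ν.inv ≫ m₃.inv) ≫
      (m₃.hom ≫ l ◁ θ ≫ m₄.inv) ≫ (m₄.hom ≫ l ◁ κ.hom ≫ (ρ_ l).hom) =
      m₁.hom ≫ ι.hom ▷ l ≫ (λ_ l).hom) :
    leftZigzag (ι.inv ≫ η ≫ μ.hom) (ν.inv ≫ θ ≫ κ.hom) = (λ_ l).hom ≫ (ρ_ l).inv := by
  simp only [Category.assoc, Iso.inv_hom_id_assoc, Iso.cancel_iso_hom_left] at h
  rw [← cancel_mono (ρ_ l).hom, ← cancel_epi (ι.hom ▷ l)]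
  simp [leftZigzag_eq, ← h]

/-- The extension of a 1-cell, as a 1-cell of fibred categories. -/
noncomputable abbrev extCell {I J : PolyObj C} (L : I ⟶ J) :
    famCat.{v, u} I.as ⟶ famCat.{v, u} J.as :=
  (Poly.extFunctor I.as J.as).obj L

/-- The unit of an adjunction of 1-cells, on extensions. -/
noncomputable def extUnit (adj : Bicategory.Adjunction L R) :
    𝟙 (famCat.{v, u} I.as) ⟶ extCell L ≫ extCell R :=
  (Poly.extOne I.as).inv ≫ (Poly.extFunctor I.as I.as).map adj.unit ≫ (Poly.extCmp L R).hom

/-- The counit of an adjunction of 1-cells, on extensions. -/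
noncomputable def extCounit (adj : Bicategory.Adjunction L R) :
    extCell R ≫ extCell L ⟶ 𝟙 (famCat.{v, u} J.as) :=
  (Poly.extCmp R L).inv ≫ (Poly.extFunctor J.as J.as).map adj.counit ≫ (Poly.extOne J.as).hom

/-- This and the next four lemmas hold because the structure 2-cells of `Poly` are defined as
preimages under the fully faithful extension functor. -/
theorem map_whiskerLeft {I J K : PolyObj C} (P : I ⟶ J) {Q Q' : J ⟶ K} (η : Q ⟶ Q') :
    (Poly.extFunctor I.as K.as).map (P ◁ η) = (Poly.extCmp P Q).hom ≫
      (extCell P ◁ (Poly.extFunctor J.as K.as).map η) ≫ (Poly.extCmp P Q').inv :=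
  (Poly.extFullyFaithful I.as K.as).map_preimage _

theorem map_whiskerRight {I J K : PolyObj C} {P P' : I ⟶ J} (η : P ⟶ P') (Q : J ⟶ K) :
    (Poly.extFunctor I.as K.as).map (η ▷ Q) = (Poly.extCmp P Q).hom ≫
      ((Poly.extFunctor I.as J.as).map η ▷ extCell Q) ≫ (Poly.extCmp P' Q).inv :=
  (Poly.extFullyFaithful I.as K.as).map_preimage _

theorem map_associator_hom {I J K M : PolyObj C} (P : I ⟶ J) (Q : J ⟶ K) (S : K ⟶ M) :
    (Poly.extFunctor I.as M.as).map (α_ P Q S).hom =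
      (Poly.extCmp (P ≫ Q) S).hom ≫ ((Poly.extCmp P Q).hom ▷ extCell S) ≫
        (α_ (extCell P) (extCell Q) (extCell S)).hom ≫ (extCell P ◁ (Poly.extCmp Q S).inv) ≫
          (Poly.extCmp P (Q ≫ S)).inv :=
  (Poly.extFullyFaithful I.as M.as).map_preimage _

theorem map_leftUnitor_hom {I J : PolyObj C} (P : I ⟶ J) :
    (Poly.extFunctor I.as J.as).map (λ_ P).hom =
      (Poly.extCmp (𝟙 I : I ⟶ I) P).hom ≫ ((Poly.extOne I.as).hom ▷ extCell P) ≫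
        (λ_ (extCell P)).hom :=
  (Poly.extFullyFaithful I.as J.as).map_preimage _

theorem map_rightUnitor_hom {I J : PolyObj C} (P : I ⟶ J) :
    (Poly.extFunctor I.as J.as).map (ρ_ P).hom =
      (Poly.extCmp P (𝟙 J : J ⟶ J)).hom ≫ (extCell P ◁ (Poly.extOne J.as).hom) ≫
        (ρ_ (extCell P)).hom :=
  (Poly.extFullyFaithful I.as J.as).map_preimage _

theorem extUnit_extCounit (adj : Bicategory.Adjunction L R) :
    leftZigzag (extUnit adj) (extCounit adj) = (λ_ (extCell L)).hom ≫ (ρ_ (extCell L)).inv := by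
  have h := adj.left_triangle
  have h' : adj.unit ▷ L ≫ (α_ L R L).hom ≫ L ◁ adj.counit ≫ (ρ_ L).hom = (λ_ L).hom := by
    rw [← cancel_mono (ρ_ L).inv, ← h]
    simp [leftZigzag_eq]
  have k := congrArg (Poly.extFunctor I.as J.as).map h'
  simp only [Functor.map_comp, map_whiskerRight, map_whiskerLeft, map_associator_hom,
    map_leftUnitor_hom, map_rightUnitor_hom] at k
  exact leftZigzag_of_comparison (Poly.extOne I.as) (Poly.extOne J.as) (Poly.extCmp L R)
    (Poly.extCmp R L) (Poly.extCmp (𝟙 I : I ⟶ I) L) (Poly.extCmp (L ≫ R) L)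
    (Poly.extCmp L (R ≫ L)) (Poly.extCmp L (𝟙 J : J ⟶ J)) _ _ k

theorem app_leftZigzag {𝒳 𝒴 : BasedCategory.{max u v, max u v + 1} C} {l : 𝒳 ⟶ 𝒴} {r : 𝒴 ⟶ 𝒳}
    (η : 𝟙 𝒳 ⟶ l ≫ r) (θ : r ≫ l ⟶ 𝟙 𝒴) (h : leftZigzag η θ = (λ_ l).hom ≫ (ρ_ l).inv)
    (X : 𝒳.obj) : l.map (η.toNatTrans.app X) ≫ θ.toNatTrans.app (l.obj X) = 𝟙 (l.obj X) := by
  have h' : η ▷ l ≫ (α_ l r l).hom ≫ l ◁ θ = (λ_ l).hom ≫ (ρ_ l).inv := by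
    rw [← h, leftZigzag_eq]
  have k := congrArg (fun τ => τ.toNatTrans.app X) h'
  -- Associators and unitors of based categories have identity components, so this holds by
  -- unfolding.
  have k' : l.map (η.toNatTrans.app X) ≫ 𝟙 _ ≫ θ.toNatTrans.app (l.obj X) = 𝟙 _ ≫ 𝟙 _ := k
  exact (congrArg (_ ≫ ·) (Category.id_comp _).symm).trans (k'.trans (Category.id_comp _))

/-- The upward map of the counit 2-cell lands in the middle object of a composite, so it selects a
position `n` of `L` and then a position `m` of `R`. Which ones is irrelevant; only their existence
is used. -/
theorem extCounit_app (adj : Bicategory.Adjunction L R) {Y : Fam.{v, u} J.as} {Γ : C}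
    (z : Poly.Elt (show Poly I.as J.as from L) ((show Poly J.as I.as from R).extObj Y) Γ) :
    ∃ (n : Γ ⟶ Poly.E L) (w : 𝟙 Γ ≫ z.b = n ≫ Poly.p L) (m : Γ ⟶ Poly.E R)
      (w' : 𝟙 Γ ≫ Poly.Elt.b (z.x (𝟙 Γ) n w) = m ≫ Poly.p R),
      FamHom.app ((extCounit adj).toNatTrans.app Y) z =
        Poly.Elt.x (P := (show Poly J.as I.as from R)) (z.x (𝟙 Γ) n w) (𝟙 Γ) m w' :=
  ⟨_, _, _, _, rfl⟩

/-- In the extension of the identity polynomial the element of `x` has the restrictions of `x` as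
components, and a 2-cell merely reindexes components; so the positions `n` and `m` have no
influence. -/
theorem extUnit_app_x_x (adj : Bicategory.Adjunction L R) {X : Fam.{v, u} I.as} {Γ T T' : C}
    (x : X.El Γ) (y : Poly.Elt (show Poly J.as I.as from R)
      ((show Poly I.as J.as from L).extObj X) Γ)
    (hy : y = FamHom.app ((extUnit adj).toNatTrans.app X) x)
    (a : T ⟶ Γ) (n : T ⟶ Poly.E R) (w : a ≫ y.b = n ≫ Poly.p R)
    (a' : T' ⟶ T) (m : T' ⟶ Poly.E L) (w' : a' ≫ Poly.Elt.b (y.x a n w) = m ≫ Poly.p L) :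
    Poly.Elt.x (P := (show Poly I.as J.as from L)) (y.x a n w) a' m w' = X.res (a' ≫ a) x := by
  subst hy
  rfl

/-- By the triangle identity, `y` is recovered by pushing it along the unit and applying the counit.
The counit keeps only the unit's value at the single component of `y` at `n`, and such a value is
constant. -/
theorem elt_eq_res_of_adjunction (adj : Bicategory.Adjunction L R) {X : Fam.{v, u} I.as} {Γ : C}
    (y : Poly.Elt (show Poly I.as J.as from L) X Γ) :
    ∃ (n : Γ ⟶ Poly.E L) (w₀ : 𝟙 Γ ≫ y.b = n ≫ Poly.p L),
      ∀ {T : C} (a : T ⟶ Γ) (m : T ⟶ Poly.E L) (w : a ≫ y.b = m ≫ Poly.p L),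
        y.x a m w = X.res a (y.x (𝟙 Γ) n w₀) := by
  let P : Poly I.as J.as := L
  let Q : Poly J.as I.as := R
  let η : FamHom X (Q.extObj (P.extObj X)) := (extUnit adj).toNatTrans.app X
  obtain ⟨n, w, m, w', h⟩ := extCounit_app adj (Y := P.extObj X) (y.push η)
  have w₀ : 𝟙 Γ ≫ y.b = n ≫ P.p := w
  have hy : y = Poly.Elt.x (P := Q) (η.app (y.x (𝟙 Γ) n w₀)) (𝟙 Γ) m w' := by
    refine Eq.trans ?_ h
    exact (congrArg (fun φ : FamHom (P.extObj X) (P.extObj X) => φ.app y)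
      (app_leftZigzag _ _ (extUnit_extCounit adj) X)).symm
  refine ⟨n, w₀, fun {T} a k w => ?_⟩
  have e := extUnit_app_x_x adj (y.x (𝟙 Γ) n w₀) _ rfl (𝟙 Γ) m w' a k
    ((congrArg (fun z : P.Elt X Γ => a ≫ z.b) hy).symm.trans w)
  rw [Category.comp_id] at e
  exact (Poly.Elt.x_congr hy rfl rfl w _).trans e

theorem isIso_of_adjunction (adj : Bicategory.Adjunction L R) : IsIso (Poly.p L) := by
  -- The component of `univ` at `m` is `m`. Taking `m = 𝟙` over `a = p` gives `p ≫ n = 𝟙`, while `w`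
  -- says that `n` is a section of `p`.
  obtain ⟨n, w, h⟩ := elt_eq_res_of_adjunction adj (Poly.univ L)
  exact ⟨n, (congrArg ULift.down (h (Poly.p L) (𝟙 _) (by simp))).symm,
    w.symm.trans (Category.id_comp _)⟩

end Adjoint

/-! ### Classification of adjunctions. -/

theorem exists_iso_delta_sigma {I J : PolyObj C} (L : I ⟶ J) (h : IsIso (Poly.p L)) :
    ∃ (K : C) (g : K ⟶ I.as) (f : K ⟶ J.as), Nonempty (L ≅ delta g ≫ sigma f) := by
  let P : Poly I.as J.as := L
  have : IsIso P.p := h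
  -- Take `K = P.E`, with legs `s` and `p ≫ t`. The base of `P` is `P.B`, that of the second factor
  -- is `P.E`, whence `r = inv p`.
  have := Poly.isIso_toCmp_of_isPullback (I := I.as) (J := P.E) (K := J.as) (P := ⟨P.E, P.E, P.s, 𝟙 _, 𝟙 _⟩)
    (Q := ⟨P.E, P.E, 𝟙 _, 𝟙 _, P.p ≫ P.t⟩) P
    (A := P.E) (l := 𝟙 _) (a := 𝟙 _) (m₁ := 𝟙 _) (m₂ := 𝟙 _) (b := P.p) (r := inv P.p)
    (IsPullback.of_vert_isIso (fst := 𝟙 _) (snd := 𝟙 _) ⟨rfl⟩)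
    (IsPullback.of_vert_isIso (fst := 𝟙 _) (snd := P.p) ⟨by simp⟩)
    (IsPullback.of_vert_isIso (fst := 𝟙 _) (snd := 𝟙 _) ⟨rfl⟩) (by simp) (by simp) (by simp)
  exact ⟨P.E, P.s, P.p ≫ P.t, ⟨@asIso (Poly I.as J.as) _ _ _ _ this⟩⟩

end PolyBicat

theorem proposition2 {C : Type u} [Category.{v} C] [HasFiniteLimits C] [LocallyCartesianClosed C] :
    (∀ {X Y : C} (f : X ⟶ Y), IsIso (sigmaDeltaComp f) ∧ IsIso (deltaSigmaComp f) ∧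
      IsIso (deltaPiComp f) ∧ IsIso (piDeltaComp f)) ∧
    ∃ (adjSigma : ∀ {X Y : C} (f : X ⟶ Y), Bicategory.Adjunction (sigma f) (delta f))
      (adjPi : ∀ {X Y : C} (f : X ⟶ Y), Bicategory.Adjunction (delta f) (pi f)),
      (∀ {X Y : C} (f : X ⟶ Y),
        (adjSigma f).unit = sigmaUnit f ≫ sigmaDeltaComp f ∧
        deltaSigmaComp f ≫ (adjSigma f).counit = sigmaCounit f) ∧
      (∀ {X Y : C} (f : X ⟶ Y),
        (adjPi f).unit = piUnit f ≫ deltaPiComp f ∧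
        piDeltaComp f ≫ (adjPi f).counit = piCounit f) ∧
      ∀ {I J : PolyObj C} {L : I ⟶ J} {R : J ⟶ I} (adj : Bicategory.Adjunction L R),
        ∃ (K : C) (g : K ⟶ I.as) (f : K ⟶ J.as)
          (φ : L ≅ delta g ≫ sigma f) (ψ : R ≅ delta f ≫ pi g),
          adj.unit ≫ φ.hom ▷ R ≫ (delta g ≫ sigma f) ◁ ψ.hom =
            ((adjPi g).comp (adjSigma f)).unit ∧
          adj.counit =
            ψ.hom ▷ L ≫ (delta f ≫ pi g) ◁ φ.hom ≫ ((adjPi g).comp (adjSigma f)).counit := by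
  refine ⟨fun f => ⟨inferInstance, inferInstance, inferInstance, inferInstance⟩,
    sigmaAdj, piAdj, fun f => ⟨rfl, IsIso.hom_inv_id_assoc _ _⟩,
    fun f => ⟨rfl, IsIso.hom_inv_id_assoc _ _⟩, fun {I J L R} adj => ?_⟩
  obtain ⟨K, g, f, ⟨φ⟩⟩ := exists_iso_delta_sigma L (isIso_of_adjunction adj)
  -- Any isomorphism `φ` of left adjoints will do: its conjugate `ψ` carries both the unit and the
  -- counit.
  obtain ⟨ψ, h⟩ := adj.exists_iso_right ((piAdj g).comp (sigmaAdj f)) φ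
  exact ⟨K, g, f, φ, ψ, h⟩
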